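/- Let $X$ be a random vector in $\mathbb R^p$ ($p$ fixed), $T\in\{0,1\}$ a binary treatment, and $Y(0),Y(1)$ real potential outcomes. Assume ignorability, $Y(s)\perp T\mid X$ for $s=0,1$, and common support, i.e. the distributions of $X\mid(T=1)$ and $X\mid(T=0)$ have the same support. Assume that for $s=0,1$ the conditional distribution of $X\mid (T=s)$ is multivariate normal with a nonsingular covariance matrix $\Sigma^{(s)}$. Fix $t\in\{0,1\}$, let $X_A$ be the subvector of $X$ indexed by $A$, let $\mathcal F$ be the collection of all subsets of $\{1,\dots,p\}$, and let $$\mathcal A_t=\{A\in\mathcal F:\ Y(t)\perp T\mid X_A\}$$ be the collection of sufficient adjustment sets. The central subspace of a response $W$ given $X$ is the unique subspace of $\mathbb R^p$ of minimal dimension such that $W\perp X\mid\beta'X$ for every matrix $\beta$ whose columns form a basis of it. Let $\beta_{Y(t)}$ and $\beta_T$ be matrices whose columns span the central subspaces of $Y(t)\mid X$ and of $T\mid X$. Assume that for every $A\in\mathcal F$ for which $\beta_{Y(t)}'X$ and $\beta_T'X$ are not conditionally independent given $X_A$ there is a measurable $h:\mathbb R\to\mathbb R$, with $h(Y(t))$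 integrable and $E\{h^2(Y(t))\mid X\}<\infty$ almost surely, such that $\mathrm{Cov}[E\{h(Y(t))\mid\beta_{Y(t)}'X\},E\{T\mid\beta_T'X\}\mid X_A]$ is not almost surely zero. Let $M_{Y(t)}$ be a matrix whose column space is the central subspace of $Y(t)\mid X$ in the sub-population $T=t$, and $M_T$ a matrix whose column space is the central subspace of $T\mid X$ (candidate matrices of inverse regression). From an i.i.d. sample of size $n$ of $(X,T,Y(T))$, let $\widehat M_{Y(t)}$, $\widehat M_T$ be estimators with $\|\widehat M_{Y(t)}-M_{Y(t)}\|=O_P(n^{-1/2})$ and $\|\widehat M_T-M_T\|=O_P(n^{-1/2})$, where $\|\cdot\|$ is the spectral norm, and let $\widehat\Sigma^{(s)}$ be the sample covariance matrix of $X$ among the units with $T=s$. For nonempty $A\in\mathcal F$ put $$\widehat f_t(A)=\sum_{s=0,1}\Big\|\widehat M_{Y(t),-A}'\big\{\widehat\Sigma^{(s)}_{-A,-A}-\widehat\Sigma^{(s)}_{-A,A}(\widehat\Sigma^{(s)}_{A,A})^{-1}\widehat\Sigma^{(s)}_{A,-A}\big\}\widehat M_{T,-A}\Big\|,$$ where the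 subscript $A$ (respectively $-A$) selects the rows or columns with index in (respectively outside) $A$, and put $\widehat f_t(\emptyset)=\sum_{s=0,1}\|\widehat M_{Y(t)}'\widehat\Sigma^{(s)}\widehat M_T\|$. Enumerate $\mathcal F$ as $A_1,\dots,A_{2^p}$ with $\widehat f_t(A_k)\ge\widehat f_t(A_{k+1})$ for all $k$. Given constants $c_0\in(0,1)$ and $c_n>0$, let $R_t(0)=c_0$ and $R_t(k)=\{\widehat f_t(A_{k+1})+c_n\}/\{\widehat f_t(A_k)+c_n\}$ for $1\le k\le 2^p-1$, let $\tau$ be a minimizer of $R_t$ over $\{0,\dots,2^p-1\}$, and let $\widehat{\mathcal A}_t=\{A_k:k>\tau\}$. If $c_n\to0$ and $n^{-1/2}/c_n\to0$, then the probability that $\widehat{\mathcal A}_t=\mathcal A_t$ (whichever way ties in the enumeration and in the choice of $\tau$ are broken) tends to one as $n\to\infty$. -/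

import Mathlib

open MeasureTheory ProbabilityTheory Filter Topology
open scoped Matrix Matrix.Norms.L2Operator ENNReal

namespace AdjustmentSets

noncomputable section

/-! ### Conditional independence and the population objects -/

/-- `f` and `g` are conditionally independent given the random element `V`, under `μ`. -/
def CondIndepGiven {Ω α β γ : Type*} [MeasurableSpace Ω] [StandardBorelSpace Ω]
    [MeasurableSpace α] [MeasurableSpace β] [MeasurableSpace γ]
    (μ : Measure Ω) [IsFiniteMeasure μ] (f : Ω → α) (g : Ω → β) (V : Ω → γ) : Prop :=
  ∃ hV : Measurable V, CondIndepFun (MeasurableSpace.comap V inferInstance) hV.comap_le f g μ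

/-- The subvector `X_A`. -/
def subvector {Ω : Type*} {p : ℕ} (X : Ω → Fin p → ℝ) (A : Finset (Fin p)) :
    Ω → ({i // i ∈ A} → ℝ) :=
  fun ω i => X ω i.1

/-- The linear reduction `β' X`. -/
def reduction {Ω : Type*} {p d : ℕ} (β : Matrix (Fin p) (Fin d) ℝ) (X : Ω → Fin p → ℝ) :
    Ω → Fin d → ℝ :=
  fun ω => βᵀ *ᵥ X ω

/-- The column space of a matrix. -/
def colSpan {p d : ℕ} (β : Matrix (Fin p) (Fin d) ℝ) : Submodule ℝ (Fin p → ℝ) :=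
  Submodule.span ℝ (Set.range β.col)

/-- `S` is a dimension reduction subspace for the response `W` given `X`: every matrix `β` whose
columns form a basis of `S` satisfies `W ⊥ X | β' X`. -/
def IsReductionSubspace {Ω α : Type*} [MeasurableSpace Ω] [StandardBorelSpace Ω]
    [MeasurableSpace α] {p : ℕ} (μ : Measure Ω) [IsFiniteMeasure μ] (W : Ω → α)
    (X : Ω → Fin p → ℝ) (S : Submodule ℝ (Fin p → ℝ)) : Prop :=
  ∀ (d : ℕ) (β : Matrix (Fin p) (Fin d) ℝ), LinearIndependent ℝ β.col → colSpan β = S →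
    CondIndepGiven μ W X (reduction β X)

/-- `S` is the central subspace of `W | X` under `μ`: the unique dimension reduction subspace of
minimal dimension. -/
def IsCentralSubspace {Ω α : Type*} [MeasurableSpace Ω] [StandardBorelSpace Ω]
    [MeasurableSpace α] {p : ℕ} (μ : Measure Ω) [IsFiniteMeasure μ] (W : Ω → α)
    (X : Ω → Fin p → ℝ) (S : Submodule ℝ (Fin p → ℝ)) : Prop :=
  IsReductionSubspace μ W X S ∧
    ∀ S' : Submodule ℝ (Fin p → ℝ), IsReductionSubspace μ W X S' →
      Module.finrank ℝ S ≤ Module.finrank ℝ S' ∧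
        (Module.finrank ℝ S' = Module.finrank ℝ S → S' = S)

/-- The population restricted to the treatment group `T = s`. -/
def group {Ω : Type*} [MeasurableSpace Ω] (P : Measure Ω) (T : Ω → Fin 2) (s : Fin 2) :
    Measure Ω :=
  ProbabilityTheory.cond P (T ⁻¹' {s})

instance {Ω : Type*} [MeasurableSpace Ω] (P : Measure Ω) [IsFiniteMeasure P] (T : Ω → Fin 2)
    (s : Fin 2) : IsFiniteMeasure (group P T s) :=
  inferInstanceAs (IsFiniteMeasure (ProbabilityTheory.cond P (T ⁻¹' {s})))

/-- `Σ^(s)`, the covariance matrix of `X | (T = s)`. -/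
def groupCov {Ω : Type*} [MeasurableSpace Ω] {p : ℕ} (P : Measure Ω) (X : Ω → Fin p → ℝ)
    (T : Ω → Fin 2) (s : Fin 2) : Matrix (Fin p) (Fin p) ℝ :=
  Matrix.of fun i j => covariance (fun ω => X ω i) (fun ω => X ω j) (group P T s)

/-- The conditional covariance of real random variables given a sub-σ-algebra `m`. -/
def condCov {Ω : Type*} [MeasurableSpace Ω] (μ : Measure Ω) (U W : Ω → ℝ)
    (m : MeasurableSpace Ω) : Ω → ℝ :=
  fun ω => condExp m μ (fun ω' => U ω' * W ω') ω - condExp m μ U ω * condExp m μ W ω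

/-- The regularity condition linking a response `Y`, the treatment `T` and their reductions: for
every index set `A`, if `β_Y' X` and `β_T' X` are not conditionally independent given `X_A`, then
some `h` with `E{h²(Y) | X}` finite (and `h(Y)` integrable, so that the conditional expectations
below exist) has `Cov[E{h(Y) | β_Y' X}, E{T | β_T' X} | X_A]` not almost surely zero. -/
def Regular {Ω : Type*} [MeasurableSpace Ω] [StandardBorelSpace Ω] {p dY dT : ℕ}
    (P : Measure Ω) [IsFiniteMeasure P] (X : Ω → Fin p → ℝ) (T : Ω → Fin 2) (Y : Ω → ℝ)
    (βY : Matrix (Fin p) (Fin dY) ℝ) (βT : Matrix (Fin p) (Fin dT) ℝ) : Prop :=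
  ∀ A : Finset (Fin p),
    ¬ CondIndepGiven P (reduction βY X) (reduction βT X) (subvector X A) →
    ∃ h : ℝ → ℝ, Measurable h ∧ Integrable (fun ω => h (Y ω)) P ∧
      (∀ᵐ ω ∂P, condLExp (MeasurableSpace.comap X inferInstance) P
        (fun ω' => ENNReal.ofReal (h (Y ω') ^ 2)) ω < ∞) ∧
      ¬ (condCov P
          (condExp (MeasurableSpace.comap (reduction βY X) inferInstance) P (fun ω => h (Y ω)))
          (condExp (MeasurableSpace.comap (reduction βT X) inferInstance) P
            (fun ω => ((T ω : ℕ) : ℝ)))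
          (MeasurableSpace.comap (subvector X A) inferInstance) =ᵐ[P] 0)

/-- The collection of the sufficient adjustment sets for the potential outcome `Y`: the index sets
`A` with `Y ⊥ T | X_A`. -/
def sufficientSets {Ω : Type*} [MeasurableSpace Ω] [StandardBorelSpace Ω] {p : ℕ}
    (P : Measure Ω) [IsFiniteMeasure P] (X : Ω → Fin p → ℝ) (T : Ω → Fin 2) (Y : Ω → ℝ) :
    Set (Finset (Fin p)) :=
  {A | CondIndepGiven P Y T (subvector X A)}

/-! ### The criterion -/

/-- The rows of `M` with index outside `A`. -/
def rowsOff {p q : ℕ} (M : Matrix (Fin p) (Fin q) ℝ) (A : Finset (Fin p)) :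
    Matrix {i // i ∉ A} (Fin q) ℝ :=
  M.submatrix Subtype.val id

/-- The Schur complement `Σ_{-A,-A} - Σ_{-A,A} (Σ_{A,A})⁻¹ Σ_{A,-A}`. -/
def schurOff {p : ℕ} (S : Matrix (Fin p) (Fin p) ℝ) (A : Finset (Fin p)) :
    Matrix {i // i ∉ A} {i // i ∉ A} ℝ :=
  S.submatrix Subtype.val Subtype.val -
    S.submatrix Subtype.val (Subtype.val : {i // i ∈ A} → Fin p) *
      (S.submatrix (Subtype.val : {i // i ∈ A} → Fin p) Subtype.val)⁻¹ *
      S.submatrix (Subtype.val : {i // i ∈ A} → Fin p) Subtype.val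

/-- The criterion with candidate matrices `MY`, `MT` and covariance matrices `S 0`, `S 1`;
`‖·‖` is the spectral norm. -/
def criterion {p q r : ℕ} (MY : Matrix (Fin p) (Fin q) ℝ) (MT : Matrix (Fin p) (Fin r) ℝ)
    (S : Fin 2 → Matrix (Fin p) (Fin p) ℝ) (A : Finset (Fin p)) : ℝ :=
  if A = ∅ then ∑ s : Fin 2, ‖MYᵀ * S s * MT‖
  else ∑ s : Fin 2, ‖(rowsOff MY A)ᵀ * schurOff (S s) A * rowsOff MT A‖

/-! ### The observed sample -/

/-- One observed record `(X, T, Y(T))`. -/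
abbrev Record (p : ℕ) : Type := (Fin p → ℝ) × Fin 2 × ℝ

/-- The observed record as a function on the population: only the outcome of the received
treatment is seen. -/
def record {Ω : Type*} {p : ℕ} (X : Ω → Fin p → ℝ) (T : Ω → Fin 2) (Y : Fin 2 → Ω → ℝ) :
    Ω → Record p :=
  fun ω => (X ω, T ω, Y (T ω) ω)

/-- The units of the sample in the treatment group `s`. -/
def units {p n : ℕ} (D : Fin n → Record p) (s : Fin 2) : Finset (Fin n) :=
  Finset.univ.filter fun k => (D k).2.1 = s

/-- The sample mean of `X` in the treatment group `s`. -/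
def sampleMean {p n : ℕ} (D : Fin n → Record p) (s : Fin 2) : Fin p → ℝ :=
  fun i => ((units D s).card : ℝ)⁻¹ * ∑ k ∈ units D s, (D k).1 i

/-- The sample covariance matrix of `X` in the treatment group `s`. -/
def sampleCov {p n : ℕ} (D : Fin n → Record p) (s : Fin 2) : Matrix (Fin p) (Fin p) ℝ :=
  Matrix.of fun i j => (((units D s).card : ℝ) - 1)⁻¹ *
    ∑ k ∈ units D s, ((D k).1 i - sampleMean D s i) * ((D k).1 j - sampleMean D s j)

/-- The plug-in criterion. -/
def sampleCriterion {p q r n : ℕ} (MYhat : (Fin n → Record p) → Matrix (Fin p) (Fin q) ℝ)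
    (MThat : (Fin n → Record p) → Matrix (Fin p) (Fin r) ℝ) (D : Fin n → Record p) :
    Finset (Fin p) → ℝ :=
  criterion (MYhat D) (MThat D) (sampleCov D)

/-- `Z n = O_P(r n)`. -/
def IsBigOInProbability {Ω : Type*} [MeasurableSpace Ω] (Q : Measure Ω) (Z : ℕ → Ω → ℝ)
    (r : ℕ → ℝ) : Prop :=
  ∀ ε : ℝ≥0∞, 0 < ε → ∃ K : ℝ, ∀ᶠ n in atTop, Q {ω | K * r n < |Z n ω|} ≤ ε

/-! ### The ridge ratio rule -/

/-- The ridge ratio `R(k)` of the criterion `f` along the enumeration `A 1, A 2, …`. -/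
def ridgeRatio {p : ℕ} (f : Finset (Fin p) → ℝ) (c₀ c : ℝ) (A : ℕ → Finset (Fin p)) (k : ℕ) : ℝ :=
  if k = 0 then c₀ else (f (A (k + 1)) + c) / (f (A k) + c)

/-- `C` is a collection that the ridge ratio rule may return for the criterion `f`: for some
enumeration `A 1, …, A (2 ^ p)` of all index sets along which `f` is nonincreasing, and some
minimizer `τ` of the ridge ratio over `{0, …, 2 ^ p - 1}`, it is `{A k : k > τ}`. (Enumeration
and minimizer need not be unique when there are ties.) -/
def IsRidgeSelection {p : ℕ} (f : Finset (Fin p) → ℝ) (c₀ c : ℝ)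
    (C : Set (Finset (Fin p))) : Prop :=
  ∃ (A : ℕ → Finset (Fin p)) (τ : ℕ),
    Set.BijOn A (Set.Icc 1 (2 ^ p)) Set.univ ∧
    AntitoneOn (fun k => f (A k)) (Set.Icc 1 (2 ^ p)) ∧
    τ < 2 ^ p ∧
    (∀ k < 2 ^ p, ridgeRatio f c₀ c A τ ≤ ridgeRatio f c₀ c A k) ∧
    C = A '' Set.Ioc τ (2 ^ p)

end

end AdjustmentSets

/-! Write U = β_Y'X and V = β_T'X. The proof has a population half and a sampling half.

Population: the criterion at the true matrices vanishes exactly on the sufficient sets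
(`mem_sufficientSets_iff_criterion_eq_zero`). Ignorability and the defining property of the
reductions factor the joint conditional law of Y(t) and T given X into a function of U times a
function of V. Hence U ⊥ V | X_A makes A sufficient; conversely, sufficiency kills every covariance
in the regularity condition, which forces U ⊥ V | X_A. Since T depends on X only through V,
restricting to T = s leaves the conditional law of U given (X_A, V) unchanged, so this independence
can be tested inside either group (`condIndepFun_group_iff`); the way back to the population uses
that both group laws of X are equivalent to Lebesgue measure. Inside a group X is normal, and U ⊥ V
| X_A means that the residuals of U and V after regression on X_A are uncorrelated; their
cross-covariance is the Schur-complement matrix of the criterion (`condIndepFun_reduction_iff`). The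
same transfer identifies the central subspace of Y(t) in group t with the one in the population, so
M_Y can replace β_Y.

Sampling: the criterion is made from root-n consistent matrices by algebra, inversion at nonsingular
limits and norms, hence is root-n consistent at each of the finitely many A (`convRate_criterion`).
As n^{-1/2} = o(c_n), criterion plus ridge is c_n(1 + o(1)) on sufficient sets and bounded away from
zero on the others. The ridge ratio therefore tends to zero at the passage from insufficient to
sufficient sets, is bounded below before it and is at least 1 - o(1) after it. The value c₀ at k = 0
is the minimum when every set is sufficient. The deterministic part of this is
`setOf_isRidgeSelection_eq`. -/

namespace AdjustmentSets

/-! ### Conditional expectations and conditional independence -/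

section CondExp

variable {Ω β γ : Type*} {m m₁ m₂ : MeasurableSpace Ω} {mΩ : MeasurableSpace Ω} [MeasurableSpace β] [MeasurableSpace γ]

/-- The indicator function of an event, as a real random variable. -/
noncomputable abbrev ind (s : Set Ω) : Ω → ℝ := s.indicator fun _ => (1 : ℝ)

lemma integrable_ind {μ : Measure Ω} [IsFiniteMeasure μ] {s : Set Ω} (hs : MeasurableSet s) :
    Integrable (ind s) μ :=
  (integrable_const _).indicator hs

lemma norm_ind_le (s : Set Ω) (ω : Ω) : ‖ind s ω‖ ≤ 1 := by
  by_cases h : ω ∈ s <;> simp [ind, h]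

lemma ind_inter (s t : Set Ω) : ind (s ∩ t) = ind s * ind t := by
  ext ω; by_cases h : ω ∈ s <;> by_cases h' : ω ∈ t <;> simp [ind, h, h']

lemma integrable_mul_ind {μ : Measure Ω} {f : Ω → ℝ} (hf : Integrable f μ) {s : Set Ω}
    (hs : MeasurableSet s) : Integrable (f * ind s) μ := by
  have : f * ind s = s.indicator f := by
    ext ω; by_cases h : ω ∈ s <;> simp [ind, h]
  rw [this]; exact hf.indicator hs

lemma integral_mul_ind {μ : Measure Ω} (f : Ω → ℝ) {s : Set Ω} (hs : MeasurableSet s) :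
    ∫ ω, (f * ind s) ω ∂μ = ∫ ω in s, f ω ∂μ := by
  have : f * ind s = s.indicator f := by
    ext ω; by_cases h : ω ∈ s <;> simp [ind, h]
  rw [this, integral_indicator hs]

lemma stronglyMeasurable_ind {s : Set Ω} (hs : MeasurableSet[m] s) :
    StronglyMeasurable[m] (ind s) :=
  stronglyMeasurable_const.indicator hs

/-- Conditional expectation given a join of σ-algebras, tested on the generating rectangles. -/
lemma condExp_sup_eq_of_forall_inter {μ : Measure Ω} [IsFiniteMeasure μ]
    (h₁ : m₁ ≤ mΩ) (h₂ : m₂ ≤ mΩ) {f k : Ω → ℝ} (hf : Integrable f μ)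
    (hk : Integrable k μ) (hkm : StronglyMeasurable[m₁ ⊔ m₂] k)
    (h : ∀ s t, MeasurableSet[m₁] s → MeasurableSet[m₂] t →
      ∫ ω in s ∩ t, k ω ∂μ = ∫ ω in s ∩ t, f ω ∂μ) :
    μ[f | m₁ ⊔ m₂] =ᵐ[μ] k := by
  have hm : m₁ ⊔ m₂ ≤ mΩ := sup_le h₁ h₂
  symm
  refine ae_eq_condExp_of_forall_setIntegral_eq hm hf (fun _ _ _ => hk.integrableOn) ?_
    hkm.aestronglyMeasurable
  intro u hu _
  have hgen : m₁ ⊔ m₂ = MeasurableSpace.generateFrom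
      (Set.image2 (· ∩ ·) {s | MeasurableSet[m₁] s} {t | MeasurableSet[m₂] t}) := by
    apply le_antisymm
    · refine sup_le (fun s hs => ?_) (fun t ht => ?_)
      · exact MeasurableSpace.measurableSet_generateFrom
          ⟨s, hs, Set.univ, @MeasurableSet.univ _ m₂, by simp⟩
      · exact MeasurableSpace.measurableSet_generateFrom
          ⟨Set.univ, @MeasurableSet.univ _ m₁, t, ht, by simp⟩
    · refine MeasurableSpace.generateFrom_le ?_
      rintro _ ⟨s, hs, t, ht, rfl⟩
      exact MeasurableSet.inter (le_sup_left (a := m₁) (b := m₂) s hs)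
        (le_sup_right (a := m₁) (b := m₂) t ht)
  have hpi : IsPiSystem
      (Set.image2 (· ∩ ·) {s | MeasurableSet[m₁] s} {t | MeasurableSet[m₂] t}) := by
    rintro _ ⟨s, hs, t, ht, rfl⟩ _ ⟨s', hs', t', ht', rfl⟩ _
    exact ⟨s ∩ s', @MeasurableSet.inter _ m₁ _ _ hs hs', t ∩ t', @MeasurableSet.inter _ m₂ _ _ ht ht',
      by simp only; rw [Set.inter_inter_inter_comm]⟩
  have huniv : ∫ ω, k ω ∂μ = ∫ ω, f ω ∂μ := by
    simpa using h Set.univ Set.univ (@MeasurableSet.univ _ m₁) (@MeasurableSet.univ _ m₂)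
  induction u, hu using MeasurableSpace.induction_on_inter hgen hpi with
  | empty => simp
  | basic t ht => obtain ⟨s, hs, t, ht, rfl⟩ := ht; exact h s t hs ht
  | compl t ht ih =>
    have ih := ih (measure_lt_top _ _)
    have e1 := integral_add_compl (hm t ht) hk
    have e2 := integral_add_compl (hm t ht) hf
    linarith
  | iUnion s hd hs ih =>
    rw [integral_iUnion (fun i => hm _ (hs i)) hd hk.integrableOn,
      integral_iUnion (fun i => hm _ (hs i)) hd hf.integrableOn]
    exact tsum_congr fun i => ih i (measure_lt_top _ _)

/-- Conditional independence says that conditioning on more does not change the conditional law. -/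
lemma condIndepFun_iff_condExp_sup [StandardBorelSpace Ω] {μ : Measure Ω} [IsFiniteMeasure μ]
    (hm : m ≤ mΩ) {f : Ω → β} {g : Ω → γ} (hf : Measurable f)
    (hg : Measurable g) :
    CondIndepFun m hm f g μ ↔ ∀ B, MeasurableSet B →
      μ[ind (f ⁻¹' B) | m ⊔ MeasurableSpace.comap g inferInstance] =ᵐ[μ] μ[ind (f ⁻¹' B) | m] := by
  rw [condIndepFun_iff_condExp_inter_preimage_eq_mul hf hg]
  constructor
  · intro h B hB
    refine condExp_sup_eq_of_forall_inter hm hg.comap_le (integrable_ind (hf hB)) integrable_condExp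
      (stronglyMeasurable_condExp.mono le_sup_left) ?_
    rintro s _ hs ⟨C, hC, rfl⟩
    have hs' := hm s hs
    -- Pulling out the `m`-measurable factor reads the product formula as equality of two
    -- conditional expectations given `m`; integrating it over `s` gives the test on the rectangle
    -- with sides `s` and `g ⁻¹' C`.
    have e1 : μ[μ[ind (f ⁻¹' B)|m] * ind (g ⁻¹' C)|m] =ᵐ[μ] μ[ind (f ⁻¹' B) * ind (g ⁻¹' C)|m] := by
      have a1 := condExp_mul_of_stronglyMeasurable_left (μ := μ) (m := m)
        (f := μ[ind (f ⁻¹' B)|m]) (g := ind (g ⁻¹' C)) stronglyMeasurable_condExp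
        (integrable_mul_ind integrable_condExp (hg hC)) (integrable_ind (hg hC))
      have a2 := h B C hB hC
      refine a1.trans (EventuallyEq.symm ?_)
      rw [← ind_inter]
      exact a2
    have key : ∫ ω in s, (μ[ind (f ⁻¹' B)|m] * ind (g ⁻¹' C)) ω ∂μ =
        ∫ ω in s, (ind (f ⁻¹' B) * ind (g ⁻¹' C)) ω ∂μ := by
      rw [← setIntegral_condExp hm (integrable_mul_ind integrable_condExp (hg hC)) hs,
        ← setIntegral_condExp hm (integrable_mul_ind (integrable_ind (hf hB)) (hg hC)) hs]
      exact setIntegral_congr_ae hs' (e1.mono fun ω h _ => h)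
    rw [integral_mul_ind _ (hg hC), integral_mul_ind _ (hg hC)] at key
    rwa [Measure.restrict_restrict (hg hC), Set.inter_comm] at key
  · intro h B C hB hC
    have hle : m ⊔ MeasurableSpace.comap g inferInstance ≤ mΩ := sup_le hm hg.comap_le
    have hgC : MeasurableSet[m ⊔ MeasurableSpace.comap g inferInstance] (g ⁻¹' C) :=
      le_sup_right (a := m) _ ⟨C, hC, rfl⟩
    have a1 : μ[ind (f ⁻¹' B) * ind (g ⁻¹' C) | m ⊔ MeasurableSpace.comap g inferInstance] =ᵐ[μ]
        μ[ind (f ⁻¹' B) | m] * ind (g ⁻¹' C) :=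
      (condExp_mul_of_stronglyMeasurable_right (stronglyMeasurable_ind hgC)
        (integrable_mul_ind (integrable_ind (hf hB)) (hg hC)) (integrable_ind (hf hB))).trans
        ((h B hB).mul (EventuallyEq.refl _ _))
    have a2 := condExp_mul_of_stronglyMeasurable_left (μ := μ) (m := m)
        (f := μ[ind (f ⁻¹' B)|m]) (g := ind (g ⁻¹' C)) stronglyMeasurable_condExp
        (integrable_mul_ind integrable_condExp (hg hC)) (integrable_ind (hg hC))
    have a3 := condExp_condExp_of_le (μ := μ) (f := ind (f ⁻¹' B) * ind (g ⁻¹' C))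
      (le_sup_left (a := m) (b := MeasurableSpace.comap g inferInstance)) hle
    change μ[ind (f ⁻¹' B ∩ g ⁻¹' C)|m] =ᵐ[μ] _
    rw [ind_inter]
    exact a3.symm.trans ((condExp_congr_ae a1).trans a2)

/-- Exhibits the conditional expectation as a continuous map of `u` in L¹ of the law of `f`, so that
coincidence of two conditional expectations becomes a closed condition. -/
lemma condExp_comp_ae_eq_condExpL1CLM {μ : Measure Ω} [IsFiniteMeasure μ] {ν : Measure β}
    (hm : m ≤ mΩ) {f : Ω → β} (mp : MeasurePreserving f μ ν) (u : β →₁[ν] ℝ) :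
    μ[fun ω => u (f ω) | m] =ᵐ[μ] condExpL1CLM ℝ hm μ (Lp.compMeasurePreserving f mp u) := by
  have hi : Integrable (fun ω => u (f ω)) μ :=
    mp.integrable_comp_of_integrable (L1.integrable_coeFn u)
  refine (condExp_ae_eq_condExpL1CLM hm hi).trans (EventuallyEq.of_eq ?_)
  have : Integrable.toL1 _ hi = Lp.compMeasurePreserving f mp u :=
    Lp.ext ((Integrable.coeFn_toL1 hi).trans (Lp.coeFn_compMeasurePreserving u mp).symm)
  rw [this]

/-- By linearity and L¹ density under the law of `f`, agreement on events extends to integrable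
functions. Needed because linear functions of X and `h(Y)` are unbounded. -/
lemma condExp_comp_eq_of_forall_ind {μ : Measure Ω} [IsFiniteMeasure μ]
    (hm₁ : m₁ ≤ mΩ) (hm₂ : m₂ ≤ mΩ) {f : Ω → β} (hf : Measurable f)
    (h : ∀ B, MeasurableSet B → μ[ind (f ⁻¹' B) | m₂] =ᵐ[μ] μ[ind (f ⁻¹' B) | m₁])
    {k : β → ℝ} (hk : Measurable k) (hint : Integrable (fun ω => k (f ω)) μ) :
    μ[fun ω => k (f ω) | m₂] =ᵐ[μ] μ[fun ω => k (f ω) | m₁] := by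
  have hint' : Integrable k (μ.map f) :=
    (integrable_map_measure hk.aestronglyMeasurable hf.aemeasurable).2 hint
  have mp : MeasurePreserving f μ (μ.map f) := hf.measurePreserving μ
  refine Integrable.induction (fun k => μ[fun ω => k (f ω) | m₂] =ᵐ[μ] μ[fun ω => k (f ω) | m₁])
    ?_ ?_ ?_ ?_ hint'
  · intro c s hs _
    have : (fun ω => s.indicator (fun _ => c) (f ω)) = c • ind (f ⁻¹' s) := by
      ext ω; by_cases hω : f ω ∈ s <;> simp [ind, hω]
    rw [this]
    exact (condExp_smul _ _ _).trans (((h s hs).const_smul c).trans (condExp_smul _ _ _).symm)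
  · intro u v _ hu hv h1 h2
    have hu' := mp.integrable_comp_of_integrable hu
    have hv' := mp.integrable_comp_of_integrable hv
    exact (condExp_add hu' hv' _).trans ((h1.add h2).trans (condExp_add hu' hv' _).symm)
  · have hc : ∀ {m} (hm : m ≤ mΩ), Continuous fun u : β →₁[μ.map f] ℝ =>
        condExpL1CLM ℝ hm μ (Lp.compMeasurePreserving f mp u) := fun hm =>
      (condExpL1CLM ℝ hm μ).continuous.comp
        (Lp.compMeasurePreservingₗᵢ ℝ f mp (E := ℝ) (p := 1)).continuous
    have hset : {u : β →₁[μ.map f] ℝ |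
          μ[fun ω => u (f ω) | m₂] =ᵐ[μ] μ[fun ω => u (f ω) | m₁]} =
        {u | condExpL1CLM ℝ hm₂ μ (Lp.compMeasurePreserving f mp u) =
          condExpL1CLM ℝ hm₁ μ (Lp.compMeasurePreserving f mp u)} := by
      ext u
      have e₁ := condExp_comp_ae_eq_condExpL1CLM hm₁ mp u
      have e₂ := condExp_comp_ae_eq_condExpL1CLM hm₂ mp u
      refine ⟨fun hu => Lp.ext (e₂.symm.trans (EventuallyEq.trans hu e₁)), fun hu => ?_⟩
      refine e₂.trans (EventuallyEq.trans ?_ e₁.symm)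
      rw [show condExpL1CLM ℝ hm₂ μ (Lp.compMeasurePreserving f mp u) = _ from hu]
    rw [hset]
    exact isClosed_eq (hc hm₂) (hc hm₁)
  · intro u v huv _ h1
    have huv' : (fun ω => u (f ω)) =ᵐ[μ] fun ω => v (f ω) := ae_of_ae_map hf.aemeasurable huv
    exact (condExp_congr_ae huv').symm.trans (h1.trans (condExp_congr_ae huv'))

/-! ### Passing between a treatment group and the population -/

section Transfer

variable {P : Measure Ω} {T : Ω → Fin 2} {s : Fin 2}

lemma integral_group (f : Ω → ℝ) :
    ∫ ω, f ω ∂(group P T s) = (P (T ⁻¹' {s}))⁻¹.toReal * ∫ ω in T ⁻¹' {s}, f ω ∂P := by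
  rw [group, ProbabilityTheory.cond, integral_smul_measure, smul_eq_mul]

lemma group_absolutelyContinuous : group P T s ≪ P := cond_absolutelyContinuous

/-- The null case is separate: there the normalizing scalar is infinite, but the group measure is
zero. -/
lemma integrable_group {f : Ω → ℝ} (hf : Integrable f P) : Integrable f (group P T s) := by
  by_cases h : P (T ⁻¹' {s}) = 0
  · have : group P T s = 0 := cond_eq_zero_of_meas_eq_zero h
    rw [this]; exact integrable_zero_measure
  · exact (hf.restrict (s := T ⁻¹' {s})).smul_measure (ENNReal.inv_ne_top.2 h)

/-- Under conditional independence from the treatment, conditional expectations of an event in a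
treatment group agree with those in the population. -/
lemma condExp_group_eq [IsFiniteMeasure P] (hm : m ≤ mΩ) (hT : Measurable T) {E : Set Ω} (hE : MeasurableSet E)
    (h : P[ind (E ∩ T ⁻¹' {s}) | m] =ᵐ[P] P[ind E | m] * P[ind (T ⁻¹' {s}) | m]) :
    (group P T s)[ind E | m] =ᵐ[group P T s] P[ind E | m] := by
  have hTs : MeasurableSet (T ⁻¹' {s}) := hT (measurableSet_singleton s)
  symm
  refine ae_eq_condExp_of_forall_setIntegral_eq hm (integrable_ind hE)
    (fun _ _ _ => (integrable_group integrable_condExp).integrableOn) ?_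
    stronglyMeasurable_condExp.aestronglyMeasurable
  intro u hu _
  have hu' := hm u hu
  rw [← integral_indicator hu', ← integral_indicator hu', integral_group, integral_group]
  congr 1
  have swap : ∀ f : Ω → ℝ, ∫ ω in T ⁻¹' {s}, u.indicator f ω ∂P =
      ∫ ω in u, (f * ind (T ⁻¹' {s})) ω ∂P := by
    intro f
    rw [setIntegral_indicator hu', ← Measure.restrict_restrict hTs, integral_mul_ind _ hTs]
  -- Since `u` is `m`-measurable, both integrals may be taken after conditioning on `m`; the
  -- integrands then agree by the product hypothesis.
  rw [swap, swap, ← setIntegral_condExp hm (integrable_mul_ind integrable_condExp hTs) hu,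
    ← setIntegral_condExp hm (integrable_mul_ind (integrable_ind hE) hTs) hu]
  refine setIntegral_congr_ae hu' (Eventually.mono ?_ fun ω h _ => h)
  rw [← ind_inter]
  exact (condExp_mul_of_stronglyMeasurable_left stronglyMeasurable_condExp
    (integrable_mul_ind integrable_condExp hTs) (integrable_ind hTs)).trans h.symm

/-- Functions of `X` that agree almost surely in a group agree almost surely in the population, when
the laws of `X` are equivalent. -/
lemma ae_eq_of_ae_eq_group {α : Type*} [MeasurableSpace α] {X : Ω → α} (hX : Measurable X)
    (hac : P.map X ≪ (group P T s).map X) {u v : Ω → ℝ}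
    (hu : StronglyMeasurable[MeasurableSpace.comap X inferInstance] u)
    (hv : StronglyMeasurable[MeasurableSpace.comap X inferInstance] v)
    (h : u =ᵐ[group P T s] v) : u =ᵐ[P] v := by
  have hmeas : MeasurableSet[MeasurableSpace.comap X inferInstance] {ω | u ω = v ω} :=
    hu.measurableSet_eq_fun hv
  obtain ⟨S, hS, hSe⟩ := hmeas
  have h1 : ∀ᵐ x ∂(group P T s).map X, x ∈ S := by
    refine (ae_map_iff hX.aemeasurable hS).2 ?_
    filter_upwards [h] with ω hω
    have : ω ∈ X ⁻¹' S := by rw [hSe]; exact hω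
    exact this
  filter_upwards [ae_of_ae_map hX.aemeasurable (hac.ae_le h1)] with ω hω
  have : ω ∈ {ω | u ω = v ω} := by rw [← hSe]; exact hω
  exact this

/-- Conditional independence in a treatment group is equivalent to conditional independence in the
population, when the treatment does not alter the conditional law of `f`. -/
lemma condIndepFun_group_iff [StandardBorelSpace Ω] [IsFiniteMeasure P] {α : Type*}
    [MeasurableSpace α] {X : Ω → α} (hX : Measurable X) (hT : Measurable T)
    (hac : P.map X ≪ (group P T s).map X) (hm : m ≤ mΩ) {f : Ω → β} {g : Ω → γ}
    (hf : Measurable f) (hg : Measurable g)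
    (hle : m ⊔ MeasurableSpace.comap g inferInstance ≤ MeasurableSpace.comap X inferInstance)
    (h : ∀ B, MeasurableSet B →
      P[ind (f ⁻¹' B ∩ T ⁻¹' {s}) | m ⊔ MeasurableSpace.comap g inferInstance] =ᵐ[P]
        P[ind (f ⁻¹' B) | m ⊔ MeasurableSpace.comap g inferInstance] *
          P[ind (T ⁻¹' {s}) | m ⊔ MeasurableSpace.comap g inferInstance]) :
    CondIndepFun m hm f g (group P T s) ↔ CondIndepFun m hm f g P := by
  rw [condIndepFun_iff_condExp_sup hm hf hg, condIndepFun_iff_condExp_sup hm hf hg]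
  refine forall₂_congr fun B hB => ?_
  have hm2 : m ⊔ MeasurableSpace.comap g inferInstance ≤ mΩ := sup_le hm hg.comap_le
  -- The finer conditional probability is the same in the group and in the population, so only its
  -- reducibility to `m` has to be transferred.
  have hG := condExp_group_eq hm2 hT (hf hB) (h B hB)
  constructor
  · intro h1
    have h2 : P[ind (f ⁻¹' B) | m ⊔ MeasurableSpace.comap g inferInstance] =ᵐ[P]
        (group P T s)[ind (f ⁻¹' B) | m] :=
      ae_eq_of_ae_eq_group hX hac (stronglyMeasurable_condExp.mono hle)
        (stronglyMeasurable_condExp.mono (le_sup_left.trans hle)) (hG.symm.trans h1)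
    refine h2.trans ?_
    -- The finer conditional probability now equals some `m`-measurable function; conditioning on
    -- `m` and the tower property identify that function.
    have h3 := (condExp_condExp_of_le (μ := P) (f := ind (f ⁻¹' B))
      (le_sup_left (a := m) (b := MeasurableSpace.comap g inferInstance)) hm2).symm.trans
        (condExp_congr_ae h2)
    rw [condExp_of_stronglyMeasurable hm stronglyMeasurable_condExp
      (integrable_condExp.congr h2)] at h3
    exact h3.symm
  · intro h1
    have h2 := hG.trans (group_absolutelyContinuous.ae_le h1)
    refine h2.trans ?_
    have h3 := (condExp_condExp_of_le (μ := group P T s) (f := ind (f ⁻¹' B))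
      (le_sup_left (a := m) (b := MeasurableSpace.comap g inferInstance)) hm2).symm.trans
        (condExp_congr_ae h2)
    rw [condExp_of_stronglyMeasurable hm stronglyMeasurable_condExp
      (integrable_group integrable_condExp)] at h3
    exact h3.symm

end Transfer

end CondExp

/-! ### Gaussian vectors, regression residuals and Schur complements -/

section Gaussian

lemma pi_absolutelyContinuous {n : ℕ} (μ ν : Fin n → Measure ℝ) [∀ i, SigmaFinite (μ i)]
    [∀ i, SigmaFinite (ν i)] (h : ∀ i, μ i ≪ ν i) : Measure.pi μ ≪ Measure.pi ν := by
  induction n with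
  | zero => rw [Measure.pi_of_empty, Measure.pi_of_empty]
  | succ n ih =>
    have hμ := (measurePreserving_piFinSuccAbove μ 0).symm
    have hν := (measurePreserving_piFinSuccAbove ν 0).symm
    rw [← hμ.map_eq, ← hν.map_eq]
    exact ((h 0).prod (ih _ _ fun i => h _)).map hμ.measurable

variable {Ω : Type*} [MeasurableSpace Ω] {μ : Measure Ω} {p : ℕ} {X : Ω → Fin p → ℝ}

/-- The covariance matrix of a random vector. -/
noncomputable def covMatrix (μ : Measure Ω) (X : Ω → Fin p → ℝ) : Matrix (Fin p) (Fin p) ℝ :=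
  Matrix.of fun i j => cov[fun ω => X ω i, fun ω => X ω j; μ]

lemma covMatrix_symm : (covMatrix μ X)ᵀ = covMatrix μ X := by
  ext i j; exact covariance_comm _ _

lemma memLp_dotProduct (hX : HasGaussianLaw X μ) (v : Fin p → ℝ) :
    MemLp (fun ω => v ⬝ᵥ X ω) 2 μ := by
  have := hX.isProbabilityMeasure
  have h := (memLp_pi_iff.1 hX.memLp_two)
  exact memLp_finsetSum Finset.univ (f := fun i ω => v i * X ω i)
    (fun i _ => (h i).const_mul (v i))

lemma covariance_dotProduct (hX : HasGaussianLaw X μ) (v w : Fin p → ℝ) :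
    cov[fun ω => v ⬝ᵥ X ω, fun ω => w ⬝ᵥ X ω; μ] = v ⬝ᵥ covMatrix μ X *ᵥ w := by
  have := hX.isProbabilityMeasure
  have h := (memLp_pi_iff.1 hX.memLp_two)
  simp only [dotProduct, Matrix.mulVec]
  rw [covariance_fun_sum_fun_sum (fun i => (h i).const_mul (v i)) (fun i => (h i).const_mul (w i))]
  refine Finset.sum_congr rfl fun i _ => ?_
  rw [Finset.mul_sum]
  refine Finset.sum_congr rfl fun j _ => ?_
  rw [covariance_const_mul_left, covariance_const_mul_right, covMatrix, Matrix.of_apply]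
  ring

lemma hasGaussianLaw_mulVec {ι : Type*} [Fintype ι] (hX : HasGaussianLaw X μ)
    (W : Matrix ι (Fin p) ℝ) : HasGaussianLaw (fun ω => W *ᵥ X ω) μ :=
  hX.map_fun (LinearMap.toContinuousLinearMap W.mulVecLin)

/-- Both vectors are components of one linear image of `X`, hence jointly Gaussian, and then
vanishing cross-covariances suffice. -/
lemma indepFun_mulVec {ι κ : Type*} [Fintype ι] [Fintype κ] (hX : HasGaussianLaw X μ)
    (W : Matrix ι (Fin p) ℝ) (V : Matrix κ (Fin p) ℝ)
    (h : ∀ i j, W i ⬝ᵥ covMatrix μ X *ᵥ V j = 0) :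
    IndepFun (fun ω => W *ᵥ X ω) (fun ω => V *ᵥ X ω) μ := by
  refine HasGaussianLaw.indepFun_of_covariance_eval (X := fun i ω => W i ⬝ᵥ X ω)
    (Y := fun j ω => V j ⬝ᵥ X ω) ?_ fun i j => by rw [covariance_dotProduct hX, h]
  exact hX.map_fun (LinearMap.toContinuousLinearMap (W.mulVecLin.prod V.mulVecLin))

lemma map_mulVec_volume {U : Matrix (Fin p) (Fin p) ℝ} (hU : U.det ≠ 0) :
    (volume : Measure (Fin p → ℝ)).map (U *ᵥ ·) = ENNReal.ofReal |(U.det)⁻¹| • volume := by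
  have := Real.map_matrix_volume_pi_eq_smul_volume_pi hU
  exact this

/-- A nondegenerate Gaussian law is equivalent to Lebesgue measure. -/
lemma gaussian_equivalent_volume (hX : HasGaussianLaw X μ) (hS : (covMatrix μ X).PosDef) :
    μ.map X ≪ volume ∧ volume ≪ μ.map X := by
  have := hX.isProbabilityMeasure
  -- In an eigenbasis of the covariance matrix the coordinates are uncorrelated, hence independent,
  -- with the positive eigenvalues as variances. The law is thus a rotated product of nondegenerate
  -- normal laws, each equivalent to Lebesgue measure.
  set U : Matrix (Fin p) (Fin p) ℝ := (hS.1.eigenvectorUnitary : Matrix (Fin p) (Fin p) ℝ)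
    with hUdef
  have hUU : U * Uᵀ = 1 := by
    have := Unitary.coe_mul_star_self hS.1.eigenvectorUnitary
    simpa [Matrix.star_eq_conjTranspose] using this
  have hUU' : Uᵀ * U = 1 := mul_eq_one_comm.1 hUU
  have hdet : Uᵀ.det ≠ 0 := by
    intro h0
    have := congrArg Matrix.det hUU'
    rw [Matrix.det_mul, h0, zero_mul, Matrix.det_one] at this
    exact zero_ne_one this
  have hdet' : U.det ≠ 0 := by simpa using hdet
  have hdiag : Uᵀ * covMatrix μ X * U = Matrix.diagonal hS.1.eigenvalues := by
    have := hS.1.conjStarAlgAut_star_eigenvectorUnitary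
    rw [Unitary.conjStarAlgAut_star_apply] at this
    simpa [Matrix.star_eq_conjTranspose, Function.comp_def] using this
  have hcov : ∀ i j, cov[fun ω => Uᵀ i ⬝ᵥ X ω, fun ω => Uᵀ j ⬝ᵥ X ω; μ] =
      Matrix.diagonal hS.1.eigenvalues i j := by
    intro i j
    rw [covariance_dotProduct hX, ← hdiag, Matrix.mul_assoc, Matrix.mul_apply']
    rfl
  have hg : HasGaussianLaw (fun ω i => Uᵀ i ⬝ᵥ X ω) μ := hasGaussianLaw_mulVec hX Uᵀ
  have hind : iIndepFun (fun i ω => Uᵀ i ⬝ᵥ X ω) μ :=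
    hg.iIndepFun_of_covariance_eq_zero fun i j hij => by
      rw [hcov, Matrix.diagonal_apply_ne _ hij]
  have hgi : ∀ i, HasGaussianLaw (fun ω => Uᵀ i ⬝ᵥ X ω) μ := fun i => hg.eval i
  rw [iIndepFun_iff_map_fun_eq_pi_map fun i => (hgi i).aemeasurable] at hind
  have hv : ∀ i, Var[fun ω => Uᵀ i ⬝ᵥ X ω; μ].toNNReal ≠ 0 := by
    intro i
    rw [← covariance_self (hgi i).aemeasurable, hcov, Matrix.diagonal_apply_eq]
    simpa using hS.eigenvalues_pos i
  have hmap : μ.map X = (Measure.pi fun i => μ.map fun ω => Uᵀ i ⬝ᵥ X ω).map (U *ᵥ ·) := by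
    rw [← hind, AEMeasurable.map_map_of_aemeasurable (by fun_prop) hg.aemeasurable]
    congr 1
    ext ω : 1
    change X ω = U *ᵥ (Uᵀ *ᵥ X ω)
    rw [Matrix.mulVec_mulVec, hUU, Matrix.one_mulVec]
  have hprob : ∀ i, IsProbabilityMeasure (μ.map fun ω => Uᵀ i ⬝ᵥ X ω) := fun i =>
    Measure.isProbabilityMeasure_map (hgi i).aemeasurable
  have hm : Measurable (fun x : Fin p → ℝ => U *ᵥ x) := by fun_prop
  have h1 : (Measure.pi fun i => μ.map fun ω => Uᵀ i ⬝ᵥ X ω) ≪ volume :=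
    pi_absolutelyContinuous _ _ fun i => by
      rw [(hgi i).map_eq_gaussianReal]; exact gaussianReal_absolutelyContinuous _ (hv i)
  have h2 : volume ≪ (Measure.pi fun i => μ.map fun ω => Uᵀ i ⬝ᵥ X ω) :=
    pi_absolutelyContinuous _ _ fun i => by
      rw [(hgi i).map_eq_gaussianReal]; exact gaussianReal_absolutelyContinuous' _ (hv i)
  have h1' := h1.map hm
  have h2' := h2.map hm
  rw [map_mulVec_volume hdet', ← hmap] at h1' h2'
  refine ⟨h1'.trans Measure.smul_absolutelyContinuous, ?_⟩
  refine (Measure.absolutelyContinuous_smul ?_).trans h2'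
  simpa using hdet'

/-- The vector representing the residual of `w ⬝ᵥ X` after linear regression on `X_A`, for
covariance matrix `S`. -/
noncomputable def residual (S : Matrix (Fin p) (Fin p) ℝ) (A : Finset (Fin p)) (w : Fin p → ℝ) :
    Fin p → ℝ := fun i =>
  if h : i ∈ A then
    -((S.submatrix (Subtype.val : {i // i ∈ A} → Fin p) Subtype.val)⁻¹ *ᵥ
      (S.submatrix (Subtype.val : {i // i ∈ A} → Fin p) (Subtype.val : {i // i ∉ A} → Fin p) *ᵥ
        fun j => w j)) ⟨i, h⟩
  else w i

lemma residual_of_notMem {S : Matrix (Fin p) (Fin p) ℝ} {A : Finset (Fin p)} {w : Fin p → ℝ}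
    {i : Fin p} (h : i ∉ A) : residual S A w i = w i := by simp [residual, h]

lemma sum_eq_sum_mem_add_sum_notMem (A : Finset (Fin p)) (f : Fin p → ℝ) :
    ∑ i, f i = ∑ i : {i // i ∈ A}, f i + ∑ i : {i // i ∉ A}, f i := by
  rw [← Fintype.sum_subtype_add_sum_subtype (· ∈ A) f]
  congr!

/-- The common source of two facts: for `i` in `A` the right side is zero (normal equations), for
`i` outside `A` it is the Schur complement applied to `w`. -/
lemma mulVec_residual {S : Matrix (Fin p) (Fin p) ℝ} (A : Finset (Fin p)) (w : Fin p → ℝ)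
    (i : Fin p) : (S *ᵥ residual S A w) i =
      (fun j : {i // i ∉ A} => S i j) ⬝ᵥ (fun j => w j) -
      (fun j : {i // i ∈ A} => S i j) ⬝ᵥ
        ((S.submatrix (Subtype.val : {i // i ∈ A} → Fin p) Subtype.val)⁻¹ *ᵥ
      (S.submatrix (Subtype.val : {i // i ∈ A} → Fin p) (Subtype.val : {i // i ∉ A} → Fin p) *ᵥ
        fun j => w j)) := by
  rw [Matrix.mulVec, dotProduct, sum_eq_sum_mem_add_sum_notMem A, add_comm, sub_eq_add_neg,
    dotProduct, dotProduct, ← Finset.sum_neg_distrib]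
  congr 1
  · exact Finset.sum_congr rfl fun j _ => by rw [residual_of_notMem j.2]
  · refine Finset.sum_congr rfl fun j _ => ?_
    rw [residual, dif_pos j.2, mul_neg]

/-- Principal submatrices of a positive definite matrix are invertible, so `Σ_{A,A}` cancels its
inverse. These normal equations make the residual uncorrelated with `X_A`. -/
lemma mulVec_residual_of_mem {S : Matrix (Fin p) (Fin p) ℝ} (hS : S.PosDef) {A : Finset (Fin p)}
    (w : Fin p → ℝ) {i : Fin p} (hi : i ∈ A) : (S *ᵥ residual S A w) i = 0 := by
  have hu : IsUnit (S.submatrix (Subtype.val : {i // i ∈ A} → Fin p) Subtype.val).det :=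
    (Matrix.isUnit_iff_isUnit_det _).1 (hS.submatrix Subtype.val_injective).isUnit
  rw [mulVec_residual, sub_eq_zero]
  have := congrFun (congrArg (· *ᵥ (S.submatrix (Subtype.val : {i // i ∈ A} → Fin p)
    (Subtype.val : {i // i ∉ A} → Fin p) *ᵥ fun j => w j)) (Matrix.mul_nonsing_inv _ hu)) ⟨i, hi⟩
  simp only [← Matrix.mulVec_mulVec, Matrix.one_mulVec] at this
  exact this.symm

/-- The normal equations remove the coordinates in `A`. Outside `A` the left residual is the column
of `MY` itself, and the right one contributes the Schur complement. -/
lemma dotProduct_mulVec_residual {S : Matrix (Fin p) (Fin p) ℝ} (A : Finset (Fin p))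
    {q r : ℕ} (MY : Matrix (Fin p) (Fin q) ℝ) (MT : Matrix (Fin p) (Fin r) ℝ) (hS : S.PosDef)
    (k : Fin q) (l : Fin r) :
    residual S A (MY.col k) ⬝ᵥ S *ᵥ residual S A (MT.col l) =
      ((rowsOff MY A)ᵀ * schurOff S A * rowsOff MT A) k l := by
  rw [dotProduct, sum_eq_sum_mem_add_sum_notMem A, Finset.sum_eq_zero, zero_add]
  · rw [Matrix.mul_assoc, Matrix.mul_apply]
    refine Finset.sum_congr rfl fun i _ => ?_
    rw [residual_of_notMem i.2, mulVec_residual]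
    have e : (schurOff S A * rowsOff MT A) i l =
        (schurOff S A *ᵥ fun j : {i // i ∉ A} => MT.col l j) i := rfl
    have e' : schurOff S A *ᵥ (fun j : {i // i ∉ A} => MT.col l j) = _ :=
      Matrix.sub_mulVec _ _ _
    have e'' : (S.submatrix (Subtype.val : {i // i ∉ A} → Fin p)
          (Subtype.val : {i // i ∈ A} → Fin p) *
        (S.submatrix (Subtype.val : {i // i ∈ A} → Fin p) Subtype.val)⁻¹ *
        S.submatrix (Subtype.val : {i // i ∈ A} → Fin p) Subtype.val) *ᵥ
          (fun j : {i // i ∉ A} => MT.col l j) = _ :=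
      (Matrix.mulVec_mulVec _ _ _).symm.trans (Matrix.mulVec_mulVec _ _ _).symm
    rw [e, e', e'']
    rfl
  · intro i _
    rw [mulVec_residual_of_mem hS _ i.2, mul_zero]

end Gaussian

/-! ### Conditional independence of linear reductions of a Gaussian vector -/

section GaussianCondIndep

/-- Freezing lemma: conditionally on `Z`, an independent `R` keeps its law. -/
lemma condExp_eq_integral_of_indepFun {Ω β γ : Type*} [MeasurableSpace Ω] [MeasurableSpace β]
    [StandardBorelSpace β] [Nonempty β] [MeasurableSpace γ] {μ : Measure Ω} [IsFiniteMeasure μ]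
    {Z : Ω → γ} {R : Ω → β} (hZ : Measurable Z) (hR : Measurable R) (hind : IndepFun Z R μ)
    (hμ : IsProbabilityMeasure μ)
    {h : γ × β → ℝ} (hh : StronglyMeasurable h) (hint : Integrable (fun ω => h (Z ω, R ω)) μ) :
    μ[fun ω => h (Z ω, R ω) | MeasurableSpace.comap Z inferInstance] =ᵐ[μ]
      fun ω => ∫ y, h (Z ω, y) ∂(μ.map R) := by
  have h1 := condExp_prod_ae_eq_integral_condDistrib hZ hR.aemeasurable hh hint
  have : IsProbabilityMeasure (μ.map R) := Measure.isProbabilityMeasure_map hR.aemeasurable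
  -- The joint law of `(Z, R)` is a product, which disintegrates over `Z` with a constant kernel.
  have h2 : condDistrib R Z μ =ᵐ[μ.map Z] Kernel.const γ (μ.map R) := by
    refine condDistrib_ae_eq_of_measure_eq_compProd Z hR.aemeasurable ?_
    rw [Measure.compProd_const,
      (indepFun_iff_map_prod_eq_prod_map_map hZ.aemeasurable hR.aemeasurable).1 hind]
  refine h1.trans ?_
  filter_upwards [ae_of_ae_map hZ.aemeasurable h2] with ω hω
  rw [hω, Kernel.const_apply]

variable {Ω : Type*} {m₁ m₂ : MeasurableSpace Ω} {mΩ : MeasurableSpace Ω} {μ : Measure Ω} {p q r : ℕ} {X : Ω → Fin p → ℝ}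

/-- The part of `w ⬝ᵥ X` explained by `X_A`. -/
noncomputable def explained (S : Matrix (Fin p) (Fin p) ℝ) (A : Finset (Fin p)) (w : Fin p → ℝ)
    (x : {i // i ∈ A} → ℝ) : ℝ :=
  ∑ i : {i // i ∈ A}, (w i - residual S A w i) * x i

lemma measurable_explained (S : Matrix (Fin p) (Fin p) ℝ) (A : Finset (Fin p)) (w : Fin p → ℝ) :
    Measurable (explained S A w) := by
  unfold explained; fun_prop

omit mΩ in
lemma explained_add_residual (S : Matrix (Fin p) (Fin p) ℝ) (A : Finset (Fin p)) (w : Fin p → ℝ)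
    (ω : Ω) : explained S A w (subvector X A ω) + residual S A w ⬝ᵥ X ω = w ⬝ᵥ X ω := by
  simp only [explained, dotProduct, subvector]
  rw [sum_eq_sum_mem_add_sum_notMem A (fun i => residual S A w i * X ω i),
    sum_eq_sum_mem_add_sum_notMem A (fun i => w i * X ω i), ← add_assoc, ← Finset.sum_add_distrib]
  congr 1
  · exact Finset.sum_congr rfl fun i _ => by ring
  · exact Finset.sum_congr rfl fun i _ => by rw [residual_of_notMem i.2]

lemma measurable_subvector (hX : Measurable X) (A : Finset (Fin p)) :
    Measurable (subvector X A) := by unfold subvector; fun_prop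

lemma measurable_reduction (hX : Measurable X) (β : Matrix (Fin p) (Fin q) ℝ) :
    Measurable (reduction β X) := by unfold reduction; fun_prop

omit mΩ in
lemma reduction_apply (β : Matrix (Fin p) (Fin q) ℝ) (ω : Ω) (k : Fin q) :
    reduction β X ω k = β.col k ⬝ᵥ X ω := rfl

lemma indepFun_residual_subvector (hX : HasGaussianLaw X μ) (hS : (covMatrix μ X).PosDef)
    (A : Finset (Fin p)) (w : Fin p → ℝ) :
    IndepFun (fun ω => residual (covMatrix μ X) A w ⬝ᵥ X ω) (subvector X A) μ := by
  have h := indepFun_mulVec hX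
    (Matrix.of fun a : {i // i ∈ A} => (Pi.single a.1 1 : Fin p → ℝ))
    (Matrix.of fun _ : Unit => residual (covMatrix μ X) A w) (fun a _ => by
      change (Pi.single a.1 1 : Fin p → ℝ) ⬝ᵥ covMatrix μ X *ᵥ residual (covMatrix μ X) A w = 0
      rw [single_dotProduct, mulVec_residual_of_mem hS _ a.2, mul_zero])
  have h' := h.symm.comp (φ := fun x : Unit → ℝ => x ()) 
    (show Measurable fun x : Unit → ℝ => x () from measurable_pi_apply ()) measurable_id
  have e : subvector X A = id ∘ fun ω =>
      (Matrix.of fun a : {i // i ∈ A} => (Pi.single a.1 1 : Fin p → ℝ)) *ᵥ X ω := by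
    ext ω a
    change X ω a = (Pi.single a.1 1 : Fin p → ℝ) ⬝ᵥ X ω
    rw [single_dotProduct, one_mul]
  rw [e]
  exact h'

/-- Given `m₂`, the residual `RY` has the same mean as given `X_A`, a constant because `RY` is
independent of `X_A`. As `RT` is `m₂`-measurable, E(RY RT) = E(RY) E(RT), and the covariance of the
residuals is the required entry. -/
lemma cross_covariance_eq_zero_of_condExp_eq [IsFiniteMeasure μ] (hXm : Measurable X)
    (hX : HasGaussianLaw X μ) (hS : (covMatrix μ X).PosDef) (MY : Matrix (Fin p) (Fin q) ℝ)
    (MT : Matrix (Fin p) (Fin r) ℝ) (A : Finset (Fin p))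
    (hm₁ : m₁ = MeasurableSpace.comap (subvector X A) inferInstance)
    (hm₂ : m₂ = m₁ ⊔ MeasurableSpace.comap (reduction MT X) inferInstance)
    (h : ∀ B, MeasurableSet B →
      μ[ind (reduction MY X ⁻¹' B) | m₂] =ᵐ[μ] μ[ind (reduction MY X ⁻¹' B) | m₁]) :
    (rowsOff MY A)ᵀ * schurOff (covMatrix μ X) A * rowsOff MT A = 0 := by
  have hprob := hX.isProbabilityMeasure
  have hU := measurable_reduction hXm MY
  have hm1 : m₁ ≤ mΩ := hm₁ ▸ (measurable_subvector hXm A).comap_le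
  have h12 : m₁ ≤ m₂ := hm₂ ▸ le_sup_left
  have hm2 : m₂ ≤ mΩ := hm₂ ▸ sup_le hm1 (measurable_reduction hXm MT).comap_le
  set S := covMatrix μ X
  have hexp : ∀ w, StronglyMeasurable[m₁] fun ω => explained S A w (subvector X A ω) := fun w =>
    hm₁ ▸ ((measurable_explained S A w).comp (comap_measurable (subvector X A))).stronglyMeasurable
  ext k l
  rw [← dotProduct_mulVec_residual A MY MT hS, Matrix.zero_apply, ← covariance_dotProduct hX]
  set RY := fun ω => residual S A (MY.col k) ⬝ᵥ X ω with hRY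
  set RT := fun ω => residual S A (MT.col l) ⬝ᵥ X ω with hRT
  have hRY2 : MemLp RY 2 μ := memLp_dotProduct hX _
  have hRT2 : MemLp RT 2 μ := memLp_dotProduct hX _
  have hUi : Integrable (fun ω => MY.col k ⬝ᵥ X ω) μ :=
    (memLp_dotProduct hX _).integrable (by norm_num)
  have hRYi : Integrable RY μ := hRY2.integrable (by norm_num)
  have e1 : μ[fun ω => MY.col k ⬝ᵥ X ω | m₂] =ᵐ[μ] μ[fun ω => MY.col k ⬝ᵥ X ω | m₁] :=
    condExp_comp_eq_of_forall_ind hm1 hm2 hU h (measurable_pi_apply k) hUi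
  have hRYeq : RY = (fun ω => MY.col k ⬝ᵥ X ω) -
      fun ω => explained S A (MY.col k) (subvector X A ω) := by
    ext ω; simp only [Pi.sub_apply, ← explained_add_residual S A (MY.col k) ω, hRY]; ring
  have hEi : Integrable (fun ω => explained S A (MY.col k) (subvector X A ω)) μ := by
    have : (fun ω => explained S A (MY.col k) (subvector X A ω)) =
        (fun ω => MY.col k ⬝ᵥ X ω) - RY := by rw [hRYeq]; simp
    rw [this]; exact hUi.sub hRYi
  have e2 : μ[RY | m₂] =ᵐ[μ] μ[RY | m₁] := by
    rw [hRYeq]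
    refine (condExp_sub hUi hEi _).trans (EventuallyEq.trans ?_ (condExp_sub hUi hEi _).symm)
    rw [condExp_of_stronglyMeasurable hm1 (hexp _) hEi,
      condExp_of_stronglyMeasurable hm2 ((hexp _).mono h12) hEi]
    exact e1.sub (EventuallyEq.refl _ _)
  have e3 : μ[RY | m₁] =ᵐ[μ] fun _ => ∫ ω, RY ω ∂μ := by
    have hRYm : Measurable RY := by
      simp only [hRY, dotProduct]; fun_prop
    exact condExp_indep_eq hRYm.comap_le hm1
      (comap_measurable RY).stronglyMeasurable
      (hm₁ ▸ indepFun_residual_subvector hX hS A _)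
  have hRTm : StronglyMeasurable[m₂] RT := by
    have : RT = (fun ω => reduction MT X ω l) -
        fun ω => explained S A (MT.col l) (subvector X A ω) := by
      ext ω
      simp only [Pi.sub_apply, reduction_apply, ← explained_add_residual S A (MT.col l) ω, hRT]
      ring
    rw [this]
    refine StronglyMeasurable.sub ?_ ((hexp _).mono h12)
    exact (((measurable_pi_apply l).comp
      (comap_measurable (reduction MT X))).stronglyMeasurable).mono (hm₂ ▸ le_sup_right)
  have e4 : ∫ ω, (RY * RT) ω ∂μ = (∫ ω, RY ω ∂μ) * ∫ ω, RT ω ∂μ := by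
    have hint : Integrable (RY * RT) μ := hRY2.integrable_mul hRT2
    rw [← integral_condExp hm2]
    rw [integral_congr_ae ((condExp_mul_of_stronglyMeasurable_right hRTm hint hRYi).trans
      ((e2.trans e3).mul (EventuallyEq.refl _ RT)))]
    simp only [Pi.mul_apply]
    rw [integral_const_mul]
  rw [covariance_eq_sub hRY2 hRT2, e4, sub_self]

/-- The residual `R` of the first reduction is independent of `Z`, which joins `X_A` with the
residual of the second. As the first reduction is a function of `X_A` and `R`, freezing `Z` gives a
conditional probability `Φ` depending on `X_A` alone. Both `m₁` and `m₂` lie between σ(X_A) and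
σ(Z), so both yield `Φ`. -/
lemma condExp_eq_of_cross_covariance_eq_zero [IsFiniteMeasure μ] (hXm : Measurable X)
    (hX : HasGaussianLaw X μ) (hS : (covMatrix μ X).PosDef) (MY : Matrix (Fin p) (Fin q) ℝ)
    (MT : Matrix (Fin p) (Fin r) ℝ) (A : Finset (Fin p))
    (hm₁ : m₁ = MeasurableSpace.comap (subvector X A) inferInstance)
    (hm₂ : m₂ = m₁ ⊔ MeasurableSpace.comap (reduction MT X) inferInstance)
    (h : (rowsOff MY A)ᵀ * schurOff (covMatrix μ X) A * rowsOff MT A = 0)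
    {B : Set (Fin q → ℝ)} (hB : MeasurableSet B) :
    μ[ind (reduction MY X ⁻¹' B) | m₂] =ᵐ[μ] μ[ind (reduction MY X ⁻¹' B) | m₁] := by
  have hprob := hX.isProbabilityMeasure
  have hU := measurable_reduction hXm MY
  have hm1 : m₁ ≤ mΩ := hm₁ ▸ (measurable_subvector hXm A).comap_le
  have h12 : m₁ ≤ m₂ := hm₂ ▸ le_sup_left
  have hm2 : m₂ ≤ mΩ := hm₂ ▸ sup_le hm1 (measurable_reduction hXm MT).comap_le
  set S := covMatrix μ X
  set WY : Matrix (Fin q) (Fin p) ℝ := Matrix.of fun k => residual S A (MY.col k) with hWY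
  set WZ : Matrix ({i // i ∈ A} ⊕ Fin r) (Fin p) ℝ := Matrix.of
    (Sum.elim (fun a => Pi.single a.1 1) fun l => residual S A (MT.col l)) with hWZ
  set R := fun ω => WY *ᵥ X ω with hR
  set Z := fun ω => WZ *ᵥ X ω with hZ
  have hind : IndepFun Z R μ := by
    refine IndepFun.symm (indepFun_mulVec hX WY WZ fun k j => ?_)
    rcases j with a | l
    · change residual S A (MY.col k) ⬝ᵥ S *ᵥ (Pi.single a.1 1) = 0
      rw [Matrix.dotProduct_mulVec, ← Matrix.mulVec_transpose, covMatrix_symm,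
        dotProduct_single, mulVec_residual_of_mem hS _ a.2, zero_mul]
    · change residual S A (MY.col k) ⬝ᵥ S *ᵥ residual S A (MT.col l) = 0
      rw [dotProduct_mulVec_residual A MY MT hS, h, Matrix.zero_apply]
  have hRm : Measurable R := by simp only [hR]; fun_prop
  have hZm : Measurable Z := by simp only [hZ]; fun_prop
  have hsub : ∀ ω, subvector X A ω = fun a => Z ω (Sum.inl a) := by
    intro ω; ext a
    change X ω a = (Pi.single a.1 1 : Fin p → ℝ) ⬝ᵥ X ω
    rw [single_dotProduct, one_mul]
  set G : ({i // i ∈ A} → ℝ) × (Fin q → ℝ) → Fin q → ℝ := fun z k =>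
    explained S A (MY.col k) z.1 + z.2 k with hG
  have hGm : Measurable G := by
    refine measurable_pi_iff.2 fun k => ?_
    exact ((measurable_explained S A (MY.col k)).comp measurable_fst).add
      ((measurable_pi_apply k).comp measurable_snd)
  have hUG : ∀ ω, reduction MY X ω = G (subvector X A ω, R ω) := by
    intro ω; ext k
    rw [reduction_apply, ← explained_add_residual S A]
    rfl
  have hGs : StronglyMeasurable (ind (G ⁻¹' B)) := stronglyMeasurable_ind (hGm hB)
  set Φ : ({i // i ∈ A} → ℝ) → ℝ := fun x => ∫ y, ind (G ⁻¹' B) (x, y) ∂(μ.map R) with hΦ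
  have hprobR : IsProbabilityMeasure (μ.map R) :=
    Measure.isProbabilityMeasure_map hRm.aemeasurable
  have hΦm : StronglyMeasurable Φ := StronglyMeasurable.integral_prod_right' hGs
  have hΦ1 : StronglyMeasurable[m₁] fun ω => Φ (subvector X A ω) :=
    hm₁ ▸ hΦm.comp_measurable (comap_measurable (subvector X A))
  have hproj : Measurable fun z : ({i // i ∈ A} ⊕ Fin r → ℝ) × (Fin q → ℝ) =>
      ((fun a => z.1 (Sum.inl a) : {i // i ∈ A} → ℝ), z.2) := by fun_prop
  have hfun : ind (reduction MY X ⁻¹' B) =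
      fun ω => ind (G ⁻¹' B) ((fun a => Z ω (Sum.inl a)), R ω) := by
    ext ω
    rw [← hsub]
    by_cases hω : reduction MY X ω ∈ B
    · have hω' : (subvector X A ω, R ω) ∈ G ⁻¹' B := by rwa [Set.mem_preimage, ← hUG]
      rw [ind, ind, Set.indicator_of_mem hω', Set.indicator_of_mem (Set.mem_preimage.2 hω)]
    · have hω' : (subvector X A ω, R ω) ∉ G ⁻¹' B := by rwa [Set.mem_preimage, ← hUG]
      rw [ind, ind, Set.indicator_of_notMem hω', Set.indicator_of_notMem]
      exact hω
  have hcond : μ[ind (reduction MY X ⁻¹' B) | MeasurableSpace.comap Z inferInstance] =ᵐ[μ]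
      fun ω => Φ (subvector X A ω) := by
    have := condExp_eq_integral_of_indepFun hZm hRm hind hprob
      (hGs.comp_measurable hproj) (by
        have := integrable_ind (μ := μ) (hU hB)
        rw [hfun] at this
        exact this)
    rw [hfun]
    refine this.trans (EventuallyEq.of_eq ?_)
    ext ω
    rw [hsub]
    rfl
  have hZ1 : m₁ ≤ MeasurableSpace.comap Z inferInstance := by
    have : subvector X A = (fun z a => z (Sum.inl a)) ∘ Z := funext hsub
    rw [hm₁, this, ← MeasurableSpace.comap_comp]
    exact MeasurableSpace.comap_mono (Measurable.comap_le (by fun_prop))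
  have hZ2 : m₂ ≤ MeasurableSpace.comap Z inferInstance := by
    rw [hm₂]
    refine sup_le hZ1 ?_
    have : reduction MT X = (fun z l =>
        explained S A (MT.col l) (fun a => z (Sum.inl a)) + z (Sum.inr l)) ∘ Z := by
      ext ω l
      rw [reduction_apply, ← explained_add_residual S A, hsub]
      rfl
    rw [this, ← MeasurableSpace.comap_comp]
    refine MeasurableSpace.comap_mono (Measurable.comap_le (measurable_pi_iff.2 fun l => ?_))
    exact ((measurable_explained S A (MT.col l)).comp (by fun_prop)).add (by fun_prop)
  have hΦi : Integrable (fun ω => Φ (subvector X A ω)) μ := integrable_condExp.congr hcond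
  have e1 := (condExp_condExp_of_le (f := ind (reduction MY X ⁻¹' B)) hZ1
    hZm.comap_le).symm.trans (condExp_congr_ae hcond)
  have e2 := (condExp_condExp_of_le (f := ind (reduction MY X ⁻¹' B)) hZ2
    hZm.comap_le).symm.trans (condExp_congr_ae hcond)
  rw [condExp_of_stronglyMeasurable hm1 hΦ1 hΦi] at e1
  rw [condExp_of_stronglyMeasurable hm2 (hΦ1.mono h12) hΦi] at e2
  exact e2.trans e1.symm

/-- For a nondegenerate Gaussian vector, two linear reductions are conditionally independent given
a subvector iff their conditional cross-covariance vanishes. -/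
lemma condIndepFun_reduction_iff [StandardBorelSpace Ω] [IsFiniteMeasure μ] (hXm : Measurable X)
    (hX : HasGaussianLaw X μ) (hS : (covMatrix μ X).PosDef) (MY : Matrix (Fin p) (Fin q) ℝ)
    (MT : Matrix (Fin p) (Fin r) ℝ) (A : Finset (Fin p)) :
    CondIndepGiven μ (reduction MY X) (reduction MT X) (subvector X A) ↔
      (rowsOff MY A)ᵀ * schurOff (covMatrix μ X) A * rowsOff MT A = 0 := by
  have hA := measurable_subvector hXm A
  rw [CondIndepGiven, exists_prop_of_true hA, condIndepFun_iff_condExp_sup hA.comap_le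
    (measurable_reduction hXm MY) (measurable_reduction hXm MT)]
  exact ⟨cross_covariance_eq_zero_of_condExp_eq hXm hX hS MY MT A rfl rfl,
    fun h _ hB => condExp_eq_of_cross_covariance_eq_zero hXm hX hS MY MT A rfl rfl h hB⟩

end GaussianCondIndep

/-! ### General facts on conditional independence -/

section ConditionalIndependence

variable {Ω β γ : Type*} {m m₁ m₂ m₃ : MeasurableSpace Ω} {mΩ : MeasurableSpace Ω}
  [MeasurableSpace β] [MeasurableSpace γ] {μ : Measure Ω} [IsFiniteMeasure μ]

/-- If conditioning on `m₃` is the same as conditioning on the smaller `m₁`, then so is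
conditioning on anything in between. -/
lemma condExp_eq_of_le_of_le (h12 : m₁ ≤ m₂) (h23 : m₂ ≤ m₃) (h3 : m₃ ≤ mΩ) {f : Ω → ℝ}
    (h : μ[f | m₃] =ᵐ[μ] μ[f | m₁]) : μ[f | m₂] =ᵐ[μ] μ[f | m₁] := by
  have e := (condExp_condExp_of_le (f := f) h23 h3).symm.trans (condExp_congr_ae h)
  rwa [condExp_of_stronglyMeasurable (h23.trans h3) (stronglyMeasurable_condExp.mono h12)
    integrable_condExp] at e

omit [IsFiniteMeasure μ] in
lemma ae_abs_condExp_ind_le (s : Set Ω) : ∀ᵐ ω ∂μ, ‖(μ[ind s | m]) ω‖ ≤ 1 := by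
  have := ae_bdd_abs_condExp_of_ae_bdd_abs (μ := μ) (m := m) (R := 1) (f := ind s)
    (Eventually.of_forall fun ω => by simpa using norm_ind_le s ω)
  filter_upwards [this] with ω h using by simpa using h

variable [StandardBorelSpace Ω]

/-- Conditional expectations of products factor under conditional independence. -/
lemma condExp_mul_eq_of_condIndepFun (hm : m ≤ mΩ) {f : Ω → β} {g : Ω → γ} (hf : Measurable f)
    (hg : Measurable g) (h : CondIndepFun m hm f g μ) {k : β → ℝ} (hk : Measurable k)
    (hint : Integrable (fun ω => k (f ω)) μ) {l : Ω → ℝ}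
    (hl : StronglyMeasurable[MeasurableSpace.comap g inferInstance] l)
    {C : ℝ} (hC : ∀ᵐ ω ∂μ, ‖l ω‖ ≤ C) :
    μ[(fun ω => k (f ω)) * l | m] =ᵐ[μ] μ[fun ω => k (f ω) | m] * μ[l | m] := by
  have hm2 : m ⊔ MeasurableSpace.comap g inferInstance ≤ mΩ := sup_le hm hg.comap_le
  have hlm := (hl.mono hg.comap_le).aestronglyMeasurable (μ := μ)
  have hli : Integrable l μ := Integrable.of_bound hlm C hC
  have hfl : ∀ u : Ω → ℝ, Integrable u μ → Integrable (u * l) μ := fun u hu =>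
    hu.mul_bdd (c := C) hlm hC
  have h1 := condExp_comp_eq_of_forall_ind hm hm2 hf
    ((condIndepFun_iff_condExp_sup hm hf hg).1 h) hk hint
  have h2 : μ[(fun ω => k (f ω)) * l | m ⊔ MeasurableSpace.comap g inferInstance] =ᵐ[μ]
      μ[fun ω => k (f ω) | m] * l :=
    (condExp_mul_of_stronglyMeasurable_right (hl.mono (le_sup_right (a := m))) (hfl _ hint) hint).trans
      (h1.mul (EventuallyEq.refl _ _))
  refine (condExp_condExp_of_le (le_sup_left (a := m)) hm2).symm.trans
    ((condExp_congr_ae h2).trans ?_)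
  exact condExp_mul_of_stronglyMeasurable_left stronglyMeasurable_condExp
    (hfl _ integrable_condExp) hli

lemma condIndepFun_congr_comap {β' γ' : Type*} [MeasurableSpace β'] [MeasurableSpace γ']
    (hm₁ : m₁ ≤ mΩ) (hm₂ : m₂ ≤ mΩ) (hm : m₁ = m₂) {f : Ω → β} {f' : Ω → β'} {g : Ω → γ}
    {g' : Ω → γ'}
    (hf : MeasurableSpace.comap f inferInstance = MeasurableSpace.comap f' inferInstance)
    (hg : MeasurableSpace.comap g inferInstance = MeasurableSpace.comap g' inferInstance) :
    CondIndepFun m₁ hm₁ f g μ ↔ CondIndepFun m₂ hm₂ f' g' μ := by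
  subst hm
  rw [condIndepFun_iff_condIndep, condIndepFun_iff_condIndep]
  change CondIndep m₁ (MeasurableSpace.comap f inferInstance)
    (MeasurableSpace.comap g inferInstance) hm₁ μ ↔ _
  rw [hf, hg]

end ConditionalIndependence

/-! ### Linear reductions depend only on column spaces -/

section Reduction

variable {Ω : Type*} {p d d' : ℕ}

/-- Writing the columns of `β` as combinations of those of `β'` makes one reduction a linear
function of the other. -/
lemma comap_reduction_le_of_colSpan_le {X : Ω → Fin p → ℝ} {β : Matrix (Fin p) (Fin d) ℝ}
    {β' : Matrix (Fin p) (Fin d') ℝ} (h : colSpan β ≤ colSpan β') :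
    MeasurableSpace.comap (reduction β X) inferInstance ≤
      MeasurableSpace.comap (reduction β' X) inferInstance := by
  have hc : ∀ k, ∃ c : Fin d' → ℝ, ∑ l, c l • β'.col l = β.col k := fun k =>
    (Submodule.mem_span_range_iff_exists_fun ℝ).1 (h (Submodule.subset_span ⟨k, rfl⟩))
  choose c hc using hc
  have hred : reduction β X = (fun u k => ∑ l, c k l * u l) ∘ reduction β' X := by
    ext ω k
    change β.col k ⬝ᵥ X ω = ∑ l, c k l * (β'.col l ⬝ᵥ X ω)
    rw [← hc k, sum_dotProduct]
    simp
  rw [hred, ← MeasurableSpace.comap_comp]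
  exact MeasurableSpace.comap_mono (Measurable.comap_le (by fun_prop))

lemma comap_reduction_eq {X : Ω → Fin p → ℝ} {β : Matrix (Fin p) (Fin d) ℝ}
    {β' : Matrix (Fin p) (Fin d') ℝ} (h : colSpan β = colSpan β') :
    MeasurableSpace.comap (reduction β X) inferInstance =
      MeasurableSpace.comap (reduction β' X) inferInstance :=
  le_antisymm (comap_reduction_le_of_colSpan_le h.le) (comap_reduction_le_of_colSpan_le h.ge)

lemma comap_reduction_le (X : Ω → Fin p → ℝ) (β : Matrix (Fin p) (Fin d) ℝ) :
    MeasurableSpace.comap (reduction β X) inferInstance ≤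
      MeasurableSpace.comap X inferInstance := by
  have : reduction β X = (βᵀ *ᵥ ·) ∘ X := rfl
  rw [this, ← MeasurableSpace.comap_comp]
  exact MeasurableSpace.comap_mono (Measurable.comap_le (by fun_prop))

lemma comap_subvector_le (X : Ω → Fin p → ℝ) (A : Finset (Fin p)) :
    MeasurableSpace.comap (subvector X A) inferInstance ≤
      MeasurableSpace.comap X inferInstance := by
  have : subvector X A = (fun x a => x a.1) ∘ X := rfl
  rw [this, ← MeasurableSpace.comap_comp]
  exact MeasurableSpace.comap_mono (Measurable.comap_le (by fun_prop))

variable [MeasurableSpace Ω] [StandardBorelSpace Ω] {α : Type*} [MeasurableSpace α]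
  {μ : Measure Ω} [IsFiniteMeasure μ]

/-- A reduction with any spanning matrix, not only with a basis matrix, has the defining property
of a dimension reduction subspace. -/
lemma IsReductionSubspace.condIndepGiven {W : Ω → α} {X : Ω → Fin p → ℝ}
    {β : Matrix (Fin p) (Fin d) ℝ} (hX : Measurable X)
    (h : IsReductionSubspace μ W X (colSpan β)) : CondIndepGiven μ W X (reduction β X) := by
  -- `β` may have dependent columns, while the definition speaks of bases only; a basis matrix with
  -- the same span generates the same σ-algebra.
  set b := Module.finBasis ℝ (colSpan β)
  set β' : Matrix (Fin p) (Fin (Module.finrank ℝ (colSpan β))) ℝ :=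
    Matrix.of fun i k => (b k : Fin p → ℝ) i with hβ'
  have hcol : β'.col = fun k => (b k : Fin p → ℝ) := by ext k i; rfl
  have hli : LinearIndependent ℝ β'.col := by
    rw [hcol]
    exact b.linearIndependent.map' (colSpan β).subtype (Submodule.ker_subtype _)
  have hspan : colSpan β' = colSpan β := by
    rw [colSpan, hcol, show (fun k => (b k : Fin p → ℝ)) = (colSpan β).subtype ∘ b from rfl,
      Set.range_comp, Submodule.span_image, b.span_eq, Submodule.map_top, Submodule.range_subtype]
  obtain ⟨h1, h2⟩ := h _ β' hli hspan
  exact ⟨measurable_reduction hX β, (condIndepFun_congr_comap _ _ (comap_reduction_eq hspan)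
    rfl rfl).1 h2⟩

lemma condIndepGiven_reduction_congr {X : Ω → Fin p → ℝ} (hX : Measurable X) {e e' : ℕ}
    {β : Matrix (Fin p) (Fin d) ℝ} {β' : Matrix (Fin p) (Fin d') ℝ} {δ : Matrix (Fin p) (Fin e) ℝ}
    {δ' : Matrix (Fin p) (Fin e') ℝ} (hβ : colSpan β = colSpan β') (hδ : colSpan δ = colSpan δ')
    (A : Finset (Fin p)) :
    CondIndepGiven μ (reduction β X) (reduction δ X) (subvector X A) ↔
      CondIndepGiven μ (reduction β' X) (reduction δ' X) (subvector X A) := by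
  rw [CondIndepGiven, CondIndepGiven, exists_prop_of_true (measurable_subvector hX A),
    exists_prop_of_true (measurable_subvector hX A)]
  exact condIndepFun_congr_comap _ _ rfl (comap_reduction_eq hβ) (comap_reduction_eq hδ)

end Reduction

/-! ### The population criterion and sufficient adjustment sets -/

section Population

variable {Ω : Type*} [MeasurableSpace Ω] [StandardBorelSpace Ω] {P : Measure Ω}
  [IsFiniteMeasure P] {p dY dT : ℕ} {X : Ω → Fin p → ℝ} {T : Ω → Fin 2} {Y : Ω → ℝ}

omit [StandardBorelSpace Ω] in
-- Each group law is equivalent to Lebesgue measure, so a null set of one is null for both, hence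
-- for their mixture.
lemma map_absolutelyContinuous_map_group (hX : Measurable X) (hT : Measurable T)
    (hnormal : ∀ s, IsGaussian ((group P T s).map X)) (hpos : ∀ s, (groupCov P X T s).PosDef)
    (s : Fin 2) : P.map X ≪ (group P T s).map X := by
  have hg : ∀ s, HasGaussianLaw X (group P T s) := fun s => ⟨hnormal s⟩
  refine Measure.AbsolutelyContinuous.mk fun N hN h0 => ?_
  have h1 : ∀ s', group P T s' (X ⁻¹' N) = 0 := by
    intro s'
    rw [← Measure.map_apply hX hN]
    exact (gaussian_equivalent_volume (hg s') (hpos s')).1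
      ((gaussian_equivalent_volume (hg s) (hpos s)).2 h0)
  rw [Measure.map_apply hX hN, ← sum_meas_smul_cond_fiber hT P]
  simp only [Measure.coe_finsetSum, Measure.coe_smul, Finset.sum_apply, Pi.smul_apply, smul_eq_mul]
  exact Finset.sum_eq_zero fun s' _ => by
    rw [show P[|T ← s'] (X ⁻¹' N) = 0 from h1 s', mul_zero]

/-- The dimension reduction subspaces of an outcome in a treatment group are those in the
population, under ignorability. -/
lemma isReductionSubspace_group_iff (hX : Measurable X) (hT : Measurable T) (hY : Measurable Y)
    (hign : CondIndepGiven P Y T X) {s : Fin 2} (hac : P.map X ≪ (group P T s).map X)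
    (S : Submodule ℝ (Fin p → ℝ)) :
    IsReductionSubspace (group P T s) Y X S ↔ IsReductionSubspace P Y X S := by
  refine forall₄_congr fun d β _ _ => ?_
  rw [CondIndepGiven, CondIndepGiven, exists_prop_of_true (measurable_reduction hX β),
    exists_prop_of_true (measurable_reduction hX β)]
  have hsup : MeasurableSpace.comap (reduction β X) inferInstance ⊔
      MeasurableSpace.comap X inferInstance = MeasurableSpace.comap X inferInstance :=
    sup_eq_right.2 (comap_reduction_le X β)
  refine condIndepFun_group_iff hX hT hac (measurable_reduction hX β).comap_le hY hX hsup.le ?_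
  intro B hB
  obtain ⟨_, hign⟩ := hign
  rw [hsup]
  exact (condIndepFun_iff_condExp_inter_preimage_eq_mul hY hT).1 hign B {s} hB
    (measurableSet_singleton s)

/-- The measure enters the definition only through the reduction subspaces. This is what allows M_Y
to be found within the group `T = t`. -/
lemma isCentralSubspace_group_iff (hX : Measurable X) (hT : Measurable T) (hY : Measurable Y)
    (hign : CondIndepGiven P Y T X) {s : Fin 2} (hac : P.map X ≪ (group P T s).map X)
    (S : Submodule ℝ (Fin p → ℝ)) :
    IsCentralSubspace (group P T s) Y X S ↔ IsCentralSubspace P Y X S := by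
  simp only [IsCentralSubspace, isReductionSubspace_group_iff hX hT hY hign hac]

lemma IsCentralSubspace.unique {α : Type*} [MeasurableSpace α] {W : Ω → α}
    {S S' : Submodule ℝ (Fin p → ℝ)} (h : IsCentralSubspace P W X S)
    (h' : IsCentralSubspace P W X S') : S' = S :=
  (h.2 S' h'.1).2 (le_antisymm (h'.2 S h.1).1 (h.2 S' h'.1).1)

/-- Conditional independence of an outcome and `X` given a reduction: conditioning on `X` is the
same as conditioning on the reduction. -/
lemma CondIndepGiven.condExp_eq {α : Type*} [MeasurableSpace α] {W : Ω → α} (hX : Measurable X)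
    (hW : Measurable W) {β : Matrix (Fin p) (Fin dY) ℝ}
    (h : CondIndepGiven P W X (reduction β X)) {k : α → ℝ} (hk : Measurable k)
    (hint : Integrable (fun ω => k (W ω)) P) :
    P[fun ω => k (W ω) | MeasurableSpace.comap X inferInstance] =ᵐ[P]
      P[fun ω => k (W ω) | MeasurableSpace.comap (reduction β X) inferInstance] := by
  obtain ⟨hβ, h⟩ := h
  have h1 := (condIndepFun_iff_condExp_sup hβ.comap_le hW hX).1 h
  rw [sup_eq_right.2 (comap_reduction_le X β)] at h1
  exact condExp_comp_eq_of_forall_ind hβ.comap_le hX.comap_le hW h1 hk hint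

lemma CondIndepGiven.condExp_ind_eq {α : Type*} [MeasurableSpace α] {W : Ω → α}
    (hX : Measurable X) (hW : Measurable W) {β : Matrix (Fin p) (Fin dY) ℝ}
    (h : CondIndepGiven P W X (reduction β X)) {B : Set α} (hB : MeasurableSet B) :
    P[ind (W ⁻¹' B) | MeasurableSpace.comap X inferInstance] =ᵐ[P]
      P[ind (W ⁻¹' B) | MeasurableSpace.comap (reduction β X) inferInstance] := by
  obtain ⟨hβ, h⟩ := h
  have h1 := (condIndepFun_iff_condExp_sup hβ.comap_le hW hX).1 h B hB
  rwa [sup_eq_right.2 (comap_reduction_le X β)] at h1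

/-- When `β_T` reduces the treatment, conditional independence of reductions given `X_A` in a
treatment group is equivalent to that in the population. -/
lemma condIndepGiven_reduction_group_iff (hX : Measurable X) (hT : Measurable T)
    {βT : Matrix (Fin p) (Fin dT) ℝ} (hβT : CondIndepGiven P T X (reduction βT X)) {s : Fin 2}
    (hac : P.map X ≪ (group P T s).map X) (βY : Matrix (Fin p) (Fin dY) ℝ) (A : Finset (Fin p)) :
    CondIndepGiven (group P T s) (reduction βY X) (reduction βT X) (subvector X A) ↔
      CondIndepGiven P (reduction βY X) (reduction βT X) (subvector X A) := by
  have hA := measurable_subvector hX A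
  have hU := measurable_reduction hX βY
  have hV := measurable_reduction hX βT
  rw [CondIndepGiven, CondIndepGiven, exists_prop_of_true hA, exists_prop_of_true hA]
  have hle : MeasurableSpace.comap (subvector X A) inferInstance ⊔
      MeasurableSpace.comap (reduction βT X) inferInstance ≤ MeasurableSpace.comap X inferInstance :=
    sup_le (comap_subvector_le X A) (comap_reduction_le X βT)
  refine condIndepFun_group_iff hX hT hac hA.comap_le hU hV hle fun B hB => ?_
  have hUB : MeasurableSet (reduction βY X ⁻¹' B) := hU hB
  have hUB' : MeasurableSet[MeasurableSpace.comap X inferInstance] (reduction βY X ⁻¹' B) :=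
    comap_reduction_le X βY _ ⟨B, hB, rfl⟩
  have hTs : MeasurableSet (T ⁻¹' {s}) := hT (measurableSet_singleton s)
  have h1 := hβT.condExp_ind_eq hX hT (measurableSet_singleton s)
  have h2 := condExp_eq_of_le_of_le (le_sup_right
    (a := MeasurableSpace.comap (subvector X A) inferInstance)) hle hX.comap_le h1
  have hcomm : ∀ u v : Ω → ℝ, u * v = v * u := fun u v => mul_comm u v
  rw [ind_inter]
  -- Given X, the event on β_Y'X is known and the treatment probability depends on β_T'X alone; that
  -- factor pulls out when conditioning down to X_A and β_T'X.
  have h3 : P[ind (reduction βY X ⁻¹' B) * ind (T ⁻¹' {s}) | MeasurableSpace.comap X inferInstance]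
      =ᵐ[P] ind (reduction βY X ⁻¹' B) *
        P[ind (T ⁻¹' {s}) | MeasurableSpace.comap (reduction βT X) inferInstance] :=
    (condExp_mul_of_stronglyMeasurable_left (stronglyMeasurable_ind hUB')
      (integrable_mul_ind (integrable_ind hUB) hTs) (integrable_ind hTs)).trans
      ((EventuallyEq.refl _ _).mul h1)
  refine (condExp_condExp_of_le hle hX.comap_le).symm.trans ((condExp_congr_ae h3).trans ?_)
  refine (condExp_mul_of_stronglyMeasurable_right
    (stronglyMeasurable_condExp.mono (le_sup_right
      (a := MeasurableSpace.comap (subvector X A) inferInstance)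
      (b := MeasurableSpace.comap (reduction βT X) inferInstance))) ?_ (integrable_ind hUB)).trans
    ((EventuallyEq.refl _ _).mul h2.symm)
  rw [hcomm]
  exact integrable_mul_ind integrable_condExp hUB

/-- Conditional independence of the reductions given `X_A` makes `A` a sufficient adjustment
set. -/
lemma mem_sufficientSets_of_condIndepGiven (hX : Measurable X) (hT : Measurable T)
    (hY : Measurable Y) (hign : CondIndepGiven P Y T X)
    {βY : Matrix (Fin p) (Fin dY) ℝ} (hβY : CondIndepGiven P Y X (reduction βY X))
    {βT : Matrix (Fin p) (Fin dT) ℝ} (hβT : CondIndepGiven P T X (reduction βT X))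
    {A : Finset (Fin p)}
    (h : CondIndepGiven P (reduction βY X) (reduction βT X) (subvector X A)) :
    A ∈ sufficientSets P X T Y := by
  obtain ⟨hA, h⟩ := h
  obtain ⟨_, hign⟩ := hign
  have hU := measurable_reduction hX βY
  have hV := measurable_reduction hX βT
  refine ⟨hA, (condIndepFun_iff_condExp_inter_preimage_eq_mul hY hT).2 fun B C hB hC => ?_⟩
  have hle := comap_subvector_le X A
  have e1 : P[ind (Y ⁻¹' B ∩ T ⁻¹' C) | MeasurableSpace.comap X inferInstance] =ᵐ[P]
      P[ind (Y ⁻¹' B) | MeasurableSpace.comap (reduction βY X) inferInstance] *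
        P[ind (T ⁻¹' C) | MeasurableSpace.comap (reduction βT X) inferInstance] :=
    ((condIndepFun_iff_condExp_inter_preimage_eq_mul hY hT).1 hign B C hB hC).trans
      ((hβY.condExp_ind_eq hX hY hB).mul (hβT.condExp_ind_eq hX hT hC))
  -- Doob–Dynkin: the conditional probability is a function of β_Y'X, the form required for
  -- factoring given X_A.
  obtain ⟨k, hk, hkeq⟩ := (stronglyMeasurable_condExp (f := ind (Y ⁻¹' B))
    (m := MeasurableSpace.comap (reduction βY X) inferInstance)
    (μ := P)).measurable.exists_eq_measurable_comp
  have hki : Integrable (fun ω => k (reduction βY X ω)) P := by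
    have := integrable_condExp (f := ind (Y ⁻¹' B)) (μ := P)
      (m := MeasurableSpace.comap (reduction βY X) inferInstance)
    rwa [hkeq] at this
  have e2 := condExp_mul_eq_of_condIndepFun hA.comap_le hU hV h hk hki
    (l := P[ind (T ⁻¹' C) | MeasurableSpace.comap (reduction βT X) inferInstance])
    stronglyMeasurable_condExp (ae_abs_condExp_ind_le _)
  have hkeq' : (fun ω => k (reduction βY X ω)) =
    P[ind (Y ⁻¹' B) | MeasurableSpace.comap (reduction βY X) inferInstance] := hkeq.symm
  rw [hkeq'] at e2
  have down : ∀ {E : Set Ω} {m' : MeasurableSpace Ω},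
      P[ind E | MeasurableSpace.comap X inferInstance] =ᵐ[P] P[ind E | m'] →
      P[P[ind E | m'] | MeasurableSpace.comap (subvector X A) inferInstance] =ᵐ[P]
        P[ind E | MeasurableSpace.comap (subvector X A) inferInstance] := fun h' =>
    (condExp_congr_ae h'.symm).trans (condExp_condExp_of_le hle hX.comap_le)
  exact (condExp_condExp_of_le hle hX.comap_le).symm.trans ((condExp_congr_ae e1).trans
    (e2.trans ((down (hβY.condExp_ind_eq hX hY hB)).mul (down (hβT.condExp_ind_eq hX hT hC)))))

/-- At a sufficient adjustment set, the conditional covariances of the regularity condition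
vanish. -/
lemma condCov_eq_zero_of_mem_sufficientSets (hX : Measurable X) (hT : Measurable T)
    (hY : Measurable Y) (hign : CondIndepGiven P Y T X)
    {βY : Matrix (Fin p) (Fin dY) ℝ} (hβY : CondIndepGiven P Y X (reduction βY X))
    {βT : Matrix (Fin p) (Fin dT) ℝ} (hβT : CondIndepGiven P T X (reduction βT X))
    {A : Finset (Fin p)} (hA : A ∈ sufficientSets P X T Y) {h : ℝ → ℝ} (hh : Measurable h)
    (hint : Integrable (fun ω => h (Y ω)) P) :
    condCov P
      (P[fun ω => h (Y ω) | MeasurableSpace.comap (reduction βY X) inferInstance])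
      (P[fun ω => ((T ω : ℕ) : ℝ) | MeasurableSpace.comap (reduction βT X) inferInstance])
      (MeasurableSpace.comap (subvector X A) inferInstance) =ᵐ[P] 0 := by
  obtain ⟨hAm, hA⟩ := hA
  obtain ⟨_, hign⟩ := hign
  have hle := comap_subvector_le X A
  have hTk : Measurable fun i : Fin 2 => ((i : ℕ) : ℝ) := measurable_of_finite _
  have hTb : ∀ᵐ ω ∂P, ‖((T ω : ℕ) : ℝ)‖ ≤ 1 := Eventually.of_forall fun ω => by
    have : (T ω : ℕ) ≤ 1 := by omega
    rw [Real.norm_of_nonneg (Nat.cast_nonneg _)]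
    exact_mod_cast this
  have hTi : Integrable (fun ω => ((T ω : ℕ) : ℝ)) P :=
    Integrable.of_bound (hTk.comp hT).aestronglyMeasurable 1 hTb
  have hTs : StronglyMeasurable[MeasurableSpace.comap T inferInstance]
      fun ω => ((T ω : ℕ) : ℝ) := (hTk.comp (comap_measurable T)).stronglyMeasurable
  have hY' := hβY.condExp_eq hX hY hh hint
  have hT' := hβT.condExp_eq hX hT hTk hTi
  have e1 := (condExp_mul_eq_of_condIndepFun hX.comap_le hY hT hign hh hint hTs hTb).trans
    (hY'.mul hT')
  have e2 := condExp_mul_eq_of_condIndepFun hAm.comap_le hY hT hA hh hint hTs hTb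
  -- The product of the two reduced expectations is E{h(Y)T | X}, so averaging over X_A gives
  -- E{h(Y)T | X_A}, which factors by sufficiency (`e2`).
  have e3 := (condExp_congr_ae e1.symm).trans (condExp_condExp_of_le hle hX.comap_le)
  have d1 := (condExp_congr_ae hY'.symm).trans (condExp_condExp_of_le (μ := P)
    (f := fun ω => h (Y ω)) hle hX.comap_le)
  have d2 := (condExp_congr_ae hT'.symm).trans (condExp_condExp_of_le (μ := P)
    (f := fun ω => ((T ω : ℕ) : ℝ)) hle hX.comap_le)
  filter_upwards [e3.trans e2, d1, d2] with ω h1 h2 h3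
  simp only [Pi.mul_apply] at h1
  simp only [condCov, Pi.zero_apply]
  rw [h2, h3, sub_eq_zero, ← h1]
  rfl

/-- For empty `A` the correction in the Schur complement is a sum over no indices, so the general
formula covers that case too. -/
lemma criterion_eq_sum {q r : ℕ} (MY : Matrix (Fin p) (Fin q) ℝ) (MT : Matrix (Fin p) (Fin r) ℝ)
    (S : Fin 2 → Matrix (Fin p) (Fin p) ℝ) (A : Finset (Fin p)) :
    criterion MY MT S A = ∑ s : Fin 2, ‖(rowsOff MY A)ᵀ * schurOff (S s) A * rowsOff MT A‖ := by
  rw [criterion]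
  split_ifs with h
  · subst h
    refine Finset.sum_congr rfl fun s _ => ?_
    congr 1
    have hs : schurOff (S s) ∅ = (S s).submatrix Subtype.val Subtype.val := by
      ext i j
      refine (Matrix.sub_apply _ _ i j).trans (sub_eq_self.2 ?_)
      exact (Matrix.mul_apply).trans
        (Finset.sum_eq_zero fun a _ => absurd a.2 (Finset.notMem_empty _))
    have sum_eq : ∀ f : Fin p → ℝ, ∑ i : {i : Fin p // i ∉ (∅ : Finset (Fin p))}, f i.1 = ∑ i, f i :=
      fun f => (Equiv.subtypeUnivEquiv fun i => Finset.notMem_empty i).sum_comp f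
    ext k l
    rw [hs]
    simp only [Matrix.mul_apply, rowsOff, Matrix.transpose_apply, Matrix.submatrix_apply, id]
    rw [← sum_eq]
    refine Finset.sum_congr rfl fun i _ => ?_
    rw [← sum_eq]
  · rfl

lemma criterion_nonneg {q r : ℕ} (MY : Matrix (Fin p) (Fin q) ℝ) (MT : Matrix (Fin p) (Fin r) ℝ)
    (S : Fin 2 → Matrix (Fin p) (Fin p) ℝ) (A : Finset (Fin p)) : 0 ≤ criterion MY MT S A := by
  rw [criterion_eq_sum]
  exact Finset.sum_nonneg fun _ _ => norm_nonneg _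

/-- The population criterion vanishes exactly at the sufficient adjustment sets. -/
theorem mem_sufficientSets_iff_criterion_eq_zero {Y : Fin 2 → Ω → ℝ} (hX : Measurable X)
    (hT : Measurable T) {t : Fin 2} (hY : Measurable (Y t)) (hign : CondIndepGiven P (Y t) T X)
    {βY : Matrix (Fin p) (Fin dY) ℝ} {βT : Matrix (Fin p) (Fin dT) ℝ}
    (hβY : IsCentralSubspace P (Y t) X (colSpan βY)) (hβT : IsCentralSubspace P T X (colSpan βT))
    (hreg : Regular P X T (Y t) βY βT)
    (hnormal : ∀ s, IsGaussian ((group P T s).map X)) (hpos : ∀ s, (groupCov P X T s).PosDef)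
    {q r : ℕ} {MY : Matrix (Fin p) (Fin q) ℝ} {MT : Matrix (Fin p) (Fin r) ℝ}
    (hMY : IsCentralSubspace (group P T t) (Y t) X (colSpan MY))
    (hMT : IsCentralSubspace P T X (colSpan MT)) (A : Finset (Fin p)) :
    A ∈ sufficientSets P X T (Y t) ↔ criterion MY MT (groupCov P X T) A = 0 := by
  have hac := map_absolutelyContinuous_map_group hX hT hnormal hpos
  have hYspan := hβY.unique ((isCentralSubspace_group_iff hX hT hY hign (hac t) _).1 hMY)
  have hTspan := hβT.unique hMT
  have hYr := hβY.1.condIndepGiven hX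
  have hTr := hβT.1.condIndepGiven hX
  have h1 : A ∈ sufficientSets P X T (Y t) ↔
      CondIndepGiven P (reduction βY X) (reduction βT X) (subvector X A) := by
    refine ⟨fun hA => ?_, mem_sufficientSets_of_condIndepGiven hX hT hY hign hYr hTr⟩
    by_contra hcon
    obtain ⟨h, hh, hint, _, hne⟩ := hreg A hcon
    exact hne (condCov_eq_zero_of_mem_sufficientSets hX hT hY hign hYr hTr hA hh hint)
  have h2 : ∀ s, CondIndepGiven P (reduction βY X) (reduction βT X) (subvector X A) ↔
      (rowsOff MY A)ᵀ * schurOff (groupCov P X T s) A * rowsOff MT A = 0 := fun s => by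
    rw [condIndepGiven_reduction_congr hX hYspan.symm hTspan.symm A,
      ← condIndepGiven_reduction_group_iff hX hT (hMT.1.condIndepGiven hX) (hac s),
      condIndepFun_reduction_iff hX ⟨hnormal s⟩ (hpos s)]
    rfl
  rw [h1, criterion_eq_sum, Finset.sum_eq_zero_iff_of_nonneg fun _ _ => norm_nonneg _]
  simp only [Finset.mem_univ, true_imp_iff, norm_eq_zero]
  -- Each group alone characterizes the independence, so group 0 suffices for the converse.
  exact ⟨fun h s => (h2 s).1 h, fun h => (h2 0).2 (h 0)⟩

end Population

/-! ### Calculus of convergence rates in probability -/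

section Rates

variable {Ω : Type*} [MeasurableSpace Ω] {Q : Measure Ω} {r : ℕ → ℝ}

/-- `Z n` converges to `z` in probability at the rate `r n`. -/
def ConvRate (Q : Measure Ω) (r : ℕ → ℝ) (Z : ℕ → Ω → ℝ) (z : ℝ) : Prop :=
  IsBigOInProbability Q (fun n ω => Z n ω - z) r

lemma ConvRate.congr {Z W : ℕ → Ω → ℝ} {z : ℝ} (h : ConvRate Q r Z z)
    (he : ∀ᶠ n in atTop, ∀ ω, W n ω = Z n ω) : ConvRate Q r W z := by
  intro ε hε
  obtain ⟨K, hK⟩ := h ε hε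
  refine ⟨K, ?_⟩
  filter_upwards [hK, he] with n hn hen
  simpa only [hen] using hn

lemma ConvRate.of_abs_sub_le {Z W : ℕ → Ω → ℝ} {z w : ℝ} (h : ConvRate Q r W w)
    (hle : ∀ n ω, |Z n ω - z| ≤ |W n ω - w|) : ConvRate Q r Z z := by
  intro ε hε
  obtain ⟨K, hK⟩ := h ε hε
  refine ⟨K, hK.mono fun n hn => (measure_mono fun ω hω => ?_).trans hn⟩
  exact lt_of_lt_of_le hω (hle n ω)

lemma convRate_const (z : ℝ) : ConvRate Q r (fun _ _ => z) z := by
  intro ε _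
  refine ⟨0, Eventually.of_forall fun n => ?_⟩
  simp

/-- Delta method: differentiability at the limit gives a linear bound on a `δ`-ball, and `K * r n`
is eventually below `δ`. -/
lemma ConvRate.comp₂ (hr : ∀ n, 0 ≤ r n) (hr0 : Tendsto r atTop (𝓝 0)) {Z W : ℕ → Ω → ℝ} {z w : ℝ}
    (hZ : ConvRate Q r Z z) (hW : ConvRate Q r W w) {g : ℝ × ℝ → ℝ}
    (hg : DifferentiableAt ℝ g (z, w)) : ConvRate Q r (fun n ω => g (Z n ω, W n ω)) (g (z, w)) := by
  obtain ⟨C, hC⟩ := hg.hasFDerivAt.isBigO_sub.bound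
  obtain ⟨δ, hδ, hball⟩ := Metric.eventually_nhds_iff.1 hC
  intro ε hε
  have hε2 : 0 < ε / 2 := ENNReal.div_pos hε.ne' (by simp)
  obtain ⟨K₁, h₁⟩ := hZ (ε / 2) hε2
  obtain ⟨K₂, h₂⟩ := hW (ε / 2) hε2
  set K := max |K₁| |K₂|
  have hK0 : 0 ≤ K := (abs_nonneg _).trans (le_max_left _ _)
  refine ⟨|C| * K, ?_⟩
  have hsmall : ∀ᶠ n in atTop, K * r n < δ := by
    have : Tendsto (fun n => K * r n) atTop (𝓝 0) := by simpa using hr0.const_mul K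
    exact this.eventually_lt_const hδ
  filter_upwards [h₁, h₂, hsmall] with n hn₁ hn₂ hnδ
  calc Q {ω | |C| * K * r n < |g (Z n ω, W n ω) - g (z, w)|}
      ≤ Q ({ω | K₁ * r n < |Z n ω - z|} ∪ {ω | K₂ * r n < |W n ω - w|}) := by
        refine measure_mono fun ω hω => ?_
        by_contra hcon
        simp only [Set.mem_union, Set.mem_ofPred_eq, not_or, not_lt] at hcon
        have b₁ : |Z n ω - z| ≤ K * r n := hcon.1.trans
          (mul_le_mul_of_nonneg_right ((le_abs_self _).trans (le_max_left _ _)) (hr n))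
        have b₂ : |W n ω - w| ≤ K * r n := hcon.2.trans
          (mul_le_mul_of_nonneg_right ((le_abs_self _).trans (le_max_right _ _)) (hr n))
        have hd : dist (Z n ω, W n ω) (z, w) ≤ K * r n := max_le b₁ b₂
        have hb := hball (hd.trans_lt hnδ)
        rw [← dist_eq_norm (Z n ω, W n ω) (z, w), Real.norm_eq_abs] at hb
        have : |g (Z n ω, W n ω) - g (z, w)| ≤ |C| * K * r n :=
          hb.trans ((mul_le_mul (le_abs_self _) hd dist_nonneg (abs_nonneg _)).trans
            (mul_assoc _ _ _).ge)
        exact absurd hω (not_lt.2 this)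
    _ ≤ ε / 2 + ε / 2 := (measure_union_le _ _).trans (add_le_add hn₁ hn₂)
    _ = ε := ENNReal.add_halves ε

variable (hr : ∀ n, 0 ≤ r n) (hr0 : Tendsto r atTop (𝓝 0))
include hr hr0

lemma ConvRate.add {Z W : ℕ → Ω → ℝ} {z w : ℝ} (hZ : ConvRate Q r Z z) (hW : ConvRate Q r W w) :
    ConvRate Q r (fun n ω => Z n ω + W n ω) (z + w) :=
  hZ.comp₂ hr hr0 hW (g := fun x => x.1 + x.2) (by fun_prop)

lemma ConvRate.sub {Z W : ℕ → Ω → ℝ} {z w : ℝ} (hZ : ConvRate Q r Z z) (hW : ConvRate Q r W w) :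
    ConvRate Q r (fun n ω => Z n ω - W n ω) (z - w) :=
  hZ.comp₂ hr hr0 hW (g := fun x => x.1 - x.2) (by fun_prop)

lemma ConvRate.mul {Z W : ℕ → Ω → ℝ} {z w : ℝ} (hZ : ConvRate Q r Z z) (hW : ConvRate Q r W w) :
    ConvRate Q r (fun n ω => Z n ω * W n ω) (z * w) :=
  hZ.comp₂ hr hr0 hW (g := fun x => x.1 * x.2) (by fun_prop)

lemma ConvRate.inv {Z : ℕ → Ω → ℝ} {z : ℝ} (hZ : ConvRate Q r Z z) (hz : z ≠ 0) :
    ConvRate Q r (fun n ω => (Z n ω)⁻¹) z⁻¹ :=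
  hZ.comp₂ hr hr0 hZ (g := fun x => x.1⁻¹) (by fun_prop (disch := exact hz))

lemma ConvRate.sum {ι : Type*} (s : Finset ι) {Z : ι → ℕ → Ω → ℝ} {z : ι → ℝ}
    (h : ∀ i, ConvRate Q r (Z i) (z i)) :
    ConvRate Q r (fun n ω => ∑ i ∈ s, Z i n ω) (∑ i ∈ s, z i) := by
  classical
  induction s using Finset.induction_on with
  | empty => simpa using convRate_const 0
  | insert i s hi ih =>
    simp only [Finset.sum_insert hi]
    exact (h i).add hr hr0 ih

lemma ConvRate.prod {ι : Type*} (s : Finset ι) {Z : ι → ℕ → Ω → ℝ} {z : ι → ℝ}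
    (h : ∀ i, ConvRate Q r (Z i) (z i)) :
    ConvRate Q r (fun n ω => ∏ i ∈ s, Z i n ω) (∏ i ∈ s, z i) := by
  classical
  induction s using Finset.induction_on with
  | empty => simpa using convRate_const 1
  | insert i s hi ih =>
    simp only [Finset.prod_insert hi]
    exact (h i).mul hr hr0 ih

omit hr hr0 in
/-- Entrywise convergence of random matrices at a rate. -/
def MatConvRate {k l : Type*} (Q : Measure Ω) (r : ℕ → ℝ) (M : ℕ → Ω → Matrix k l ℝ)
    (M₀ : Matrix k l ℝ) : Prop :=
  ∀ i j, ConvRate Q r (fun n ω => M n ω i j) (M₀ i j)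

variable {k l o : Type*} [Fintype k] [Fintype l] [Fintype o]

omit [Fintype k] [Fintype o] in
lemma MatConvRate.mul {M : ℕ → Ω → Matrix k l ℝ} {M₀ : Matrix k l ℝ} {N : ℕ → Ω → Matrix l o ℝ}
    {N₀ : Matrix l o ℝ} (hM : MatConvRate Q r M M₀) (hN : MatConvRate Q r N N₀) :
    MatConvRate Q r (fun n ω => M n ω * N n ω) (M₀ * N₀) := by
  intro i j
  simp only [Matrix.mul_apply]
  exact ConvRate.sum hr hr0 _ fun a => (hM i a).mul hr hr0 (hN a j)

omit [Fintype k] [Fintype l] in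
lemma MatConvRate.sub {M N : ℕ → Ω → Matrix k l ℝ} {M₀ N₀ : Matrix k l ℝ}
    (hM : MatConvRate Q r M M₀) (hN : MatConvRate Q r N N₀) :
    MatConvRate Q r (fun n ω => M n ω - N n ω) (M₀ - N₀) :=
  fun i j => (hM i j).sub hr hr0 (hN i j)

lemma MatConvRate.det [DecidableEq k] {M : ℕ → Ω → Matrix k k ℝ} {M₀ : Matrix k k ℝ}
    (hM : MatConvRate Q r M M₀) : ConvRate Q r (fun n ω => (M n ω).det) M₀.det := by
  simp only [Matrix.det_apply']
  exact ConvRate.sum hr hr0 _ fun σ => (convRate_const _).mul hr hr0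
    (ConvRate.prod hr hr0 _ fun i => hM _ _)

/-- Cramer's rule reduces inversion to determinants. It also holds at singular `M n ω`, where the
inverses of the matrix and of its determinant are both zero by convention. -/
lemma MatConvRate.inv [DecidableEq k] {M : ℕ → Ω → Matrix k k ℝ} {M₀ : Matrix k k ℝ}
    (hM : MatConvRate Q r M M₀) (h0 : M₀.det ≠ 0) :
    MatConvRate Q r (fun n ω => (M n ω)⁻¹) M₀⁻¹ := by
  intro i j
  simp only [Matrix.inv_def, Matrix.smul_apply, Ring.inverse_eq_inv', Matrix.adjugate_apply,
    smul_eq_mul]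
  refine ((hM.det hr hr0).inv hr hr0 h0).mul hr hr0 (MatConvRate.det hr hr0 fun a b => ?_)
  simp only [Matrix.updateRow_apply]
  split_ifs
  · exact convRate_const _
  · exact hM a b

/-- The norm is not differentiable at zero, precisely the limit that matters, so the Lipschitz bound
by the entries replaces the delta method. -/
lemma MatConvRate.norm [DecidableEq k] [DecidableEq l] {M : ℕ → Ω → Matrix k l ℝ}
    {M₀ : Matrix k l ℝ} (hM : MatConvRate Q r M M₀) :
    ConvRate Q r (fun n ω => ‖M n ω‖) ‖M₀‖ := by
  have habs : ∀ i j, ConvRate Q r (fun n ω => |M n ω i j - M₀ i j|) 0 := fun i j =>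
    (hM i j).of_abs_sub_le fun n ω => by simp
  have hsum := ConvRate.sum hr hr0 Finset.univ fun i => ConvRate.sum hr hr0 Finset.univ fun j =>
    (habs i j).mul hr hr0 (convRate_const ‖Matrix.single i j (1 : ℝ)‖)
  refine hsum.of_abs_sub_le fun n ω => ?_
  simp only [zero_mul, Finset.sum_const_zero, sub_zero]
  refine (abs_norm_sub_norm_le _ _).trans (le_trans ?_ (le_abs_self _))
  calc ‖M n ω - M₀‖ = ‖∑ i, ∑ j, (M n ω i j - M₀ i j) • Matrix.single i j (1 : ℝ)‖ := by
        conv_lhs => rw [Matrix.matrix_eq_sum_single (M n ω - M₀)]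
        simp [Matrix.smul_single]
    _ ≤ _ := by
        refine (norm_sum_le _ _).trans (Finset.sum_le_sum fun i _ => (norm_sum_le _ _).trans
          (Finset.sum_le_sum fun j _ => ?_))
        rw [norm_smul, Real.norm_eq_abs]

lemma matConvRate_of_norm [DecidableEq k] [DecidableEq l] {M : ℕ → Ω → Matrix k l ℝ}
    {M₀ : Matrix k l ℝ} (h : IsBigOInProbability Q (fun n ω => ‖M n ω - M₀‖) r) :
    MatConvRate Q r M M₀ := by
  intro i j
  set L := LinearMap.toContinuousLinearMap (Matrix.entryLinearMap ℝ ℝ i j : Matrix k l ℝ →ₗ[ℝ] ℝ)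
  have h' : ConvRate Q r (fun n ω => ‖M n ω - M₀‖) 0 := by simpa [ConvRate] using h
  refine ((convRate_const ‖L‖).mul hr hr0 h').of_abs_sub_le fun n ω => ?_
  have := L.le_opNorm (M n ω - M₀)
  rw [mul_zero, sub_zero]
  exact this.trans (le_abs_self _)

/-- The criterion inherits the rate of convergence of its ingredients. -/
lemma convRate_criterion {p q q' : ℕ} {MY : ℕ → Ω → Matrix (Fin p) (Fin q) ℝ}
    {MY₀ : Matrix (Fin p) (Fin q) ℝ} {MT : ℕ → Ω → Matrix (Fin p) (Fin q') ℝ}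
    {MT₀ : Matrix (Fin p) (Fin q') ℝ} {S : Fin 2 → ℕ → Ω → Matrix (Fin p) (Fin p) ℝ}
    {S₀ : Fin 2 → Matrix (Fin p) (Fin p) ℝ} (hMY : MatConvRate Q r MY MY₀)
    (hMT : MatConvRate Q r MT MT₀) (hS : ∀ s, MatConvRate Q r (S s) (S₀ s))
    (hpos : ∀ s, (S₀ s).PosDef) (A : Finset (Fin p)) :
    ConvRate Q r (fun n ω => criterion (MY n ω) (MT n ω) (fun s => S s n ω) A)
      (criterion MY₀ MT₀ S₀ A) := by
  simp only [criterion_eq_sum]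
  refine ConvRate.sum hr hr0 _ fun s => MatConvRate.norm hr hr0 ?_
  have hdet : ((S₀ s).submatrix (Subtype.val : {i // i ∈ A} → Fin p) Subtype.val).det ≠ 0 :=
    ((hpos s).submatrix Subtype.val_injective).det_pos.ne'
  have hsub : ∀ {k' l' : Type} (f : k' → Fin p) (g : l' → Fin p),
      MatConvRate Q r (fun n ω => (S s n ω).submatrix f g) ((S₀ s).submatrix f g) :=
    fun f g i j => hS s _ _
  refine MatConvRate.mul hr hr0 (MatConvRate.mul hr hr0 (fun i j => hMY _ _)
    (MatConvRate.sub hr hr0 (hsub _ _) ?_)) (fun i j => hMT _ _)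
  exact MatConvRate.mul hr hr0 (MatConvRate.mul hr hr0 (hsub _ _)
    (MatConvRate.inv hr hr0 (hsub _ _) hdet)) (hsub _ _)

end Rates

/-! ### Root-n consistency of the group sample covariances -/

section Sample

lemma rate_nonneg (n : ℕ) : 0 ≤ (√(n : ℝ))⁻¹ := by positivity

lemma tendsto_rate : Tendsto (fun n : ℕ => (√(n : ℝ))⁻¹) atTop (𝓝 0) :=
  tendsto_inv_atTop_zero.comp (Real.tendsto_sqrt_atTop.comp tendsto_natCast_atTop_atTop)

/-- Averages of square-integrable i.i.d. variables converge at the root-`n` rate. -/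
lemma convRate_average {Ω Ω' α : Type*} [MeasurableSpace Ω] [MeasurableSpace Ω']
    [MeasurableSpace α] {P : Measure Ω} {Q : Measure Ω'} [IsProbabilityMeasure Q] {R : Ω → α}
    {D : ℕ → Ω' → α} (hindep : iIndepFun D Q) (hident : ∀ i, IdentDistrib (D i) R Q P)
    {φ : α → ℝ} (hφ : Measurable φ) (hmem : MemLp (fun ω => φ (R ω)) 2 P) :
    ConvRate Q (fun n => (√(n : ℝ))⁻¹)
      (fun n ω => (n : ℝ)⁻¹ * ∑ k : Fin n, φ (D k ω)) (∫ ω, φ (R ω) ∂P) := by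
  have hid : ∀ i, IdentDistrib (fun ω => φ (D i ω)) (fun ω => φ (R ω)) Q P := fun i =>
    (hident i).comp hφ
  have hm : ∀ i, MemLp (fun ω => φ (D i ω)) 2 Q := fun i => (hid i).memLp_iff.2 hmem
  set V := Var[fun ω => φ (R ω); P] with hV
  intro ε hε
  -- At deviation `K / √n` Chebyshev's bound is `V / K ^ 2`, free of `n`; `K` is chosen to bring it
  -- below `ε`.
  have hlim : Tendsto (fun K : ℝ => ENNReal.ofReal (V / K ^ 2)) atTop (𝓝 0) := by
    rw [← ENNReal.ofReal_zero]
    exact (ENNReal.continuous_ofReal.tendsto 0).comp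
      (tendsto_const_nhds.div_atTop (tendsto_pow_atTop two_ne_zero))
  obtain ⟨K, hKε, hK⟩ := ((hlim.eventually_lt_const hε).and (eventually_gt_atTop 0)).exists
  refine ⟨K, ?_⟩
  filter_upwards [eventually_gt_atTop 0] with n hn
  have hn' : (0 : ℝ) < n := Nat.cast_pos.2 hn
  have hsq : 0 < √(n : ℝ) := Real.sqrt_pos.2 hn'
  set Z : Ω' → ℝ := fun ω => (n : ℝ)⁻¹ * ∑ k : Fin n, φ (D k ω) with hZ
  have hsum : MemLp (∑ k : Fin n, fun ω => φ (D k ω)) 2 Q := memLp_finsetSum' _ fun k _ => hm k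
  have hZsum : Z = fun ω => (n : ℝ)⁻¹ * (∑ k : Fin n, fun ω => φ (D k ω)) ω := by
    ext ω; simp [hZ]
  have hZm : MemLp Z 2 Q := by rw [hZsum]; exact hsum.const_mul _
  have hEZ : ∫ ω, Z ω ∂Q = ∫ ω, φ (R ω) ∂P := by
    rw [hZ, integral_const_mul, 
      integral_finsetSum _ fun (k : Fin n) _ => (hm k).integrable (by norm_num)]
    simp only [(hid _).integral_eq, Finset.sum_const, Finset.card_univ, Fintype.card_fin,
      nsmul_eq_mul]
    rw [← mul_assoc, inv_mul_cancel₀ hn'.ne', one_mul]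
  have hVZ : Var[Z; Q] = V / n := by
    rw [hZsum, variance_const_mul, IndepFun.variance_sum (fun (k : Fin n) _ => hm k)]
    · simp only [(hid _).variance_eq, Finset.sum_const, Finset.card_univ, Fintype.card_fin,
        nsmul_eq_mul, ← hV]
      field_simp
    · intro i _ j _ hij
      exact (hindep.indepFun (fun h => hij (Fin.ext h))).comp hφ hφ
  have hcheb := meas_ge_le_variance_div_sq hZm (c := K * (√(n : ℝ))⁻¹) (by positivity)
  rw [hEZ, hVZ] at hcheb
  have hval : V / n / (K * (√(n : ℝ))⁻¹) ^ 2 = V / K ^ 2 := by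
    rw [mul_pow, inv_pow, Real.sq_sqrt hn'.le]
    field_simp
  rw [hval] at hcheb
  refine le_trans (measure_mono fun ω hω => ?_) (hcheb.trans hKε.le)
  exact le_of_lt (Set.mem_ofPred_eq ▸ hω)

variable {p : ℕ}

/-- The indicator of the treatment group `s` on records. -/
noncomputable def inGroup (s : Fin 2) (d : Record p) : ℝ := if d.2.1 = s then 1 else 0

lemma measurable_inGroup (s : Fin 2) : Measurable (inGroup (p := p) s) := by
  unfold inGroup
  exact Measurable.ite (measurable_snd.fst (measurableSet_singleton s)) measurable_const
    measurable_const

lemma sum_units {n : ℕ} (D : Fin n → Record p) (s : Fin 2) (f : Record p → ℝ) :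
    ∑ k ∈ units D s, f (D k) = ∑ k, inGroup s (D k) * f (D k) := by
  rw [units, Finset.sum_filter]
  refine Finset.sum_congr rfl fun k _ => ?_
  unfold inGroup
  split_ifs <;> simp

lemma card_units {n : ℕ} (D : Fin n → Record p) (s : Fin 2) :
    ((units D s).card : ℝ) = ∑ k, inGroup s (D k) := by
  have := sum_units D s fun _ => 1
  simpa using this

/-- The sample covariance in terms of averages over the whole sample. -/
lemma sampleCov_eq {n : ℕ} (hn : 0 < n) (D : Fin n → Record p) (s : Fin 2) (i j : Fin p) :
    sampleCov D s i j =
      ((n : ℝ)⁻¹ * ∑ k, inGroup s (D k) - (n : ℝ)⁻¹)⁻¹ *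
        ((n : ℝ)⁻¹ * ∑ k, inGroup s (D k) * ((D k).1 i * (D k).1 j) -
          ((n : ℝ)⁻¹ * ∑ k, inGroup s (D k) * (D k).1 i) *
            ((n : ℝ)⁻¹ * ∑ k, inGroup s (D k) * (D k).1 j) *
              ((n : ℝ)⁻¹ * ∑ k, inGroup s (D k))⁻¹) := by
  have hn' : (n : ℝ) ≠ 0 := (Nat.cast_pos.2 hn).ne'
  rw [← sum_units D s fun d => d.1 i * d.1 j, ← sum_units D s fun d => d.1 i,
    ← sum_units D s fun d => d.1 j, ← card_units, sampleCov, Matrix.of_apply]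
  simp only [sampleMean]
  set N : ℝ := ((units D s).card : ℝ) with hN
  set mi := ∑ k ∈ units D s, (D k).1 i with hmi
  set mj := ∑ k ∈ units D s, (D k).1 j with hmj
  have hexp : ∑ k ∈ units D s, ((D k).1 i - N⁻¹ * mi) * ((D k).1 j - N⁻¹ * mj) =
      ∑ k ∈ units D s, (D k).1 i * (D k).1 j - mi * mj * N⁻¹ := by
    have : ∀ k, ((D k).1 i - N⁻¹ * mi) * ((D k).1 j - N⁻¹ * mj) = (D k).1 i * (D k).1 j -
        (N⁻¹ * mj) * (D k).1 i - (N⁻¹ * mi) * (D k).1 j + N⁻¹ * mi * (N⁻¹ * mj) :=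
      fun k => by ring
    simp only [this, Finset.sum_add_distrib, Finset.sum_sub_distrib, ← Finset.mul_sum,
      Finset.sum_const, nsmul_eq_mul, ← hN, ← hmi, ← hmj]
    -- In an empty group `N⁻¹ = 0` removes all the mean terms.
    by_cases h0 : N = 0
    · simp [h0]
    · field_simp; ring
  rw [hexp]
  have h1 : ((n : ℝ)⁻¹ * N - (n : ℝ)⁻¹)⁻¹ = n * (N - 1)⁻¹ := by
    rw [← mul_sub_one, mul_inv, inv_inv]
  have h2 : ((n : ℝ)⁻¹ * N)⁻¹ = n * N⁻¹ := by rw [mul_inv, inv_inv]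
  rw [h1, h2]
  field_simp

variable {Ω : Type*} [MeasurableSpace Ω] {P : Measure Ω} [IsProbabilityMeasure P]
  {X : Ω → Fin p → ℝ} {T : Ω → Fin 2} {Y : Fin 2 → Ω → ℝ}

omit [IsProbabilityMeasure P] in
lemma integral_inGroup_record (hT : Measurable T) (s : Fin 2) (f : Ω → ℝ) :
    ∫ ω, inGroup s (record X T Y ω) * f ω ∂P = ∫ ω in T ⁻¹' {s}, f ω ∂P := by
  rw [← integral_indicator (hT (measurableSet_singleton s))]
  refine integral_congr_ae (Eventually.of_forall fun ω => ?_)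
  by_cases h : T ω = s <;> simp [inGroup, record, Set.indicator, h]

lemma memLp_inGroup_record (hT : Measurable T) {s : Fin 2} (h0 : P (T ⁻¹' {s}) ≠ 0) {f : Ω → ℝ}
    (hf : MemLp f 2 (group P T s)) :
    MemLp (fun ω => inGroup s (record X T Y ω) * f ω) 2 P := by
  have he : (fun ω => inGroup s (record X T Y ω) * f ω) = (T ⁻¹' {s}).indicator f := by
    ext ω
    by_cases h : T ω = s <;> simp [inGroup, record, Set.indicator, h]
  rw [he, memLp_indicator_iff_restrict (hT (measurableSet_singleton s))]
  have hres : P.restrict (T ⁻¹' {s}) = P (T ⁻¹' {s}) • group P T s := by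
    rw [group, ProbabilityTheory.cond, smul_smul, ENNReal.mul_inv_cancel h0 (measure_ne_top _ _),
      one_smul]
  rw [hres]
  exact hf.smul_measure (measure_ne_top _ _)

/-- The group sample covariance matrices are root-`n` consistent. -/
lemma matConvRate_sampleCov {Ω' : Type*} [MeasurableSpace Ω'] {Q : Measure Ω'}
    [IsProbabilityMeasure Q] (hT : Measurable T) {s : Fin 2}
    (hg : HasGaussianLaw X (group P T s)) {D : ℕ → Ω' → Record p}
    (hindep : iIndepFun D Q) (hident : ∀ i, IdentDistrib (D i) (record X T Y) Q P) :
    MatConvRate Q (fun n => (√(n : ℝ))⁻¹) (fun n ω => sampleCov (fun k : Fin n => D k ω) s)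
      (groupCov P X T s) := by
  intro i j
  have hprob : IsProbabilityMeasure (group P T s) := hg.isProbabilityMeasure
  have h0 : P (T ⁻¹' {s}) ≠ 0 := by
    intro h0
    have : group P T s = 0 := cond_eq_zero_of_meas_eq_zero h0
    exact IsProbabilityMeasure.ne_zero _ this
  -- Fourth moments make the products `X i * X j` square integrable, as Chebyshev requires.
  have hL4 : ∀ a, MemLp (fun ω => X ω a) 4 (group P T s) :=
    memLp_pi_iff.1 (hg.memLp (p := 4) (by norm_num))
  have hL2 : ∀ a, MemLp (fun ω => X ω a) 2 (group P T s) := memLp_pi_iff.1 hg.memLp_two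
  have hmeas := measurable_inGroup (p := p) s
  have hc : ∀ a : Fin p, Measurable fun d : Record p => d.1 a := fun a => by fun_prop
  have r1 := convRate_average hindep hident (φ := inGroup s) hmeas (by
    simpa using memLp_inGroup_record (X := X) (Y := Y) hT h0 (memLp_const (1 : ℝ)))
  have r2 : ∀ a, _ := fun a => convRate_average hindep hident
    (φ := fun d => inGroup s d * d.1 a) (hmeas.mul (hc a))
    (memLp_inGroup_record (Y := Y) hT h0 (hL2 a))
  have hprod : MemLp (fun ω => X ω i * X ω j) 2 (group P T s) :=
    (hL4 j).mul (r := 2) (hL4 i) (hpqr := ⟨by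
      rw [← two_mul, show (4 : ℝ≥0∞) = 2 * 2 by norm_num, ENNReal.mul_inv (by simp) (by simp),
        ← mul_assoc, ENNReal.mul_inv_cancel (by simp) (by simp), one_mul]⟩)
  have r3 := convRate_average hindep hident
    (φ := fun d => inGroup s d * (d.1 i * d.1 j)) (hmeas.mul ((hc i).mul (hc j)))
    (memLp_inGroup_record (Y := Y) hT h0 hprod)
  -- The divisor N - 1 of the sample covariance leaves a term 1/n, negligible at the root-n rate.
  have rn : ConvRate Q (fun n => (√(n : ℝ))⁻¹) (fun n _ => (n : ℝ)⁻¹) 0 := by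
    intro ε _
    refine ⟨1, ?_⟩
    filter_upwards [eventually_ge_atTop 1] with n hn
    have h1 : (1 : ℝ) ≤ √(n : ℝ) := Real.one_le_sqrt.2 (Nat.one_le_cast.2 hn)
    have : ¬ (1 * (√(n : ℝ))⁻¹ < |(n : ℝ)⁻¹ - 0|) := by
      rw [one_mul, sub_zero, abs_of_nonneg (by positivity), not_lt]
      refine inv_anti₀ (by linarith) ?_
      calc √(n : ℝ) ≤ √(n : ℝ) * √(n : ℝ) := by nlinarith
        _ = n := Real.mul_self_sqrt (Nat.cast_nonneg n)
    simp only [this, Set.ofPred_false, measure_empty, zero_le]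
  set π := ∫ ω, inGroup s (record X T Y ω) ∂P with hπ
  have hπval : π = (P (T ⁻¹' {s})).toReal := by
    have := integral_inGroup_record (P := P) (X := X) (Y := Y) hT s fun _ => 1
    simpa [Measure.real] using this
  have hπ0 : π ≠ 0 := by
    rw [hπval]; exact (ENNReal.toReal_pos h0 (measure_ne_top _ _)).ne'
  have key := ((r1.sub rate_nonneg tendsto_rate rn).inv rate_nonneg tendsto_rate
    (by simpa using hπ0)).mul rate_nonneg tendsto_rate
      (r3.sub rate_nonneg tendsto_rate (((r2 i).mul rate_nonneg tendsto_rate (r2 j)).mul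
        rate_nonneg tendsto_rate (r1.inv rate_nonneg tendsto_rate hπ0)))
  have hgi : ∀ f : Ω → ℝ, ∫ ω, inGroup s (record X T Y ω) * f ω ∂P =
      π * ∫ ω, f ω ∂(group P T s) := by
    intro f
    rw [integral_inGroup_record hT, integral_group, hπval, ENNReal.toReal_inv, ← mul_assoc,
      mul_inv_cancel₀ (by rwa [← hπval]), one_mul]
  have hval : groupCov P X T s i j = (π - 0)⁻¹ *
      (∫ ω, inGroup s (record X T Y ω) * (X ω i * X ω j) ∂P -
        (∫ ω, inGroup s (record X T Y ω) * X ω i ∂P) *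
          (∫ ω, inGroup s (record X T Y ω) * X ω j ∂P) * π⁻¹) := by
    rw [hgi, hgi, hgi, groupCov, Matrix.of_apply, covariance_eq_sub (hL2 i) (hL2 j)]
    simp only [Pi.mul_apply]
    field_simp
    ring
  rw [hval]
  refine key.congr ?_
  filter_upwards [eventually_gt_atTop 0] with n hn ω
  exact sampleCov_eq hn _ s i j

end Sample

/-! ### The deterministic ridge ratio rule -/

section Ridge

variable {p : ℕ} {f : Finset (Fin p) → ℝ}

/-- The index sets can be enumerated with nonincreasing values of the criterion. -/
lemma exists_antitone_enumeration (f : Finset (Fin p) → ℝ) :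
    ∃ A : ℕ → Finset (Fin p), Set.BijOn A (Set.Icc 1 (2 ^ p)) Set.univ ∧
      AntitoneOn (fun k => f (A k)) (Set.Icc 1 (2 ^ p)) := by
  have hcard : Fintype.card (Finset (Fin p)) = 2 ^ p := by simp
  set e : Fin (2 ^ p) ≃ Finset (Fin p) := (Fintype.equivFinOfCardEq hcard).symm
  set σ := Tuple.sort fun k => -f (e k) with hσ
  have hmono : Monotone ((fun k => -f (e k)) ∘ σ) := Tuple.monotone_sort _
  have hpos : 0 < 2 ^ p := by positivity
  -- Positions run from 1, `Fin` from 0; values outside `{1, …, 2 ^ p}` are immaterial.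
  set ix : ℕ → Fin (2 ^ p) := fun k => if h : k - 1 < 2 ^ p then ⟨k - 1, h⟩ else ⟨0, hpos⟩ with hix
  have hixv : ∀ k ∈ Set.Icc 1 (2 ^ p), (ix k : ℕ) = k - 1 := by
    intro k hk
    have : k - 1 < 2 ^ p := by have := hk.1; have := hk.2; omega
    simp [hix, this]
  refine ⟨fun k => e (σ (ix k)), ⟨fun _ _ => Set.mem_univ _, ?_, ?_⟩, ?_⟩
  · intro k hk l hl hkl
    have := congrArg Fin.val (σ.injective (e.injective hkl))
    rw [hixv k hk, hixv l hl] at this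
    have := hk.1; have := hl.1; omega
  · intro B _
    refine ⟨(σ.symm (e.symm B) : ℕ) + 1, ⟨by omega, (σ.symm (e.symm B)).2⟩, ?_⟩
    have : ix ((σ.symm (e.symm B) : ℕ) + 1) = σ.symm (e.symm B) := by simp [hix]
    simp [this]
  · intro k hk l hl hkl
    have hle : ix k ≤ ix l := by
      rw [Fin.le_def, hixv k hk, hixv l hl]; omega
    have := hmono hle
    simpa using this

/-- If the criterion separates `𝒜` well enough from its complement, on the scale of the ridge `c`,
the ridge ratio rule returns exactly `𝒜`, however ties are broken. -/
lemma setOf_isRidgeSelection_eq {c₀ c : ℝ} (hc : 0 < c) {𝒜 : Set (Finset (Fin p))}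
    (h𝒜 : 𝒜.Nonempty) {δ B η : ℝ} (hη : 0 ≤ η) (hδ : 0 < δ) (hlow : ∀ A ∉ 𝒜, δ ≤ f A)
    (hB : ∀ A, f A ≤ B) (hnonneg : ∀ A, 0 ≤ f A) (hsmall : ∀ A ∈ 𝒜, f A ≤ η * c)
    (h1 : η * c < δ) (h2 : c₀ * (1 + η) < 1) (h3 : (η * c + c) / (δ + c) < c₀)
    (h4 : (η * c + c) / (δ + c) < (δ + c) / (B + c)) :
    {C | IsRidgeSelection f c₀ c C} = {𝒜} := by
  have key : ∀ A : ℕ → Finset (Fin p), Set.BijOn A (Set.Icc 1 (2 ^ p)) Set.univ →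
      AntitoneOn (fun k => f (A k)) (Set.Icc 1 (2 ^ p)) →
      ∃ K < 2 ^ p, 𝒜 = A '' Set.Ioc K (2 ^ p) ∧
        ∀ k < 2 ^ p, k ≠ K → ridgeRatio f c₀ c A K < ridgeRatio f c₀ c A k := by
    intro A hbij hanti
    classical
    have hex : ∃ k, k ∈ Set.Icc 1 (2 ^ p) ∧ A k ∈ 𝒜 := by
      obtain ⟨S, hS⟩ := h𝒜
      obtain ⟨k, hk, rfl⟩ := hbij.surjOn (Set.mem_univ S)
      exact ⟨k, hk, hS⟩
    obtain ⟨hκ, hκA⟩ := Nat.find_spec hex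
    -- `κ` is the first position in `𝒜`. Since `η * c < δ`, monotonicity keeps all later positions
    -- in `𝒜`, so the cut is at `κ - 1`.
    set κ := Nat.find hex with hκdef
    have hbelow : ∀ k, 1 ≤ k → k < κ → A k ∉ 𝒜 := fun k hk1 hk hkA =>
      Nat.find_min hex hk ⟨⟨hk1, hk.le.trans hκ.2⟩, hkA⟩
    have habove : ∀ k, κ ≤ k → k ≤ 2 ^ p → A k ∈ 𝒜 := by
      intro k hk hkp
      by_contra hkA
      have h5 := hlow _ hkA
      have h6 := hanti hκ ⟨hκ.1.trans hk, hkp⟩ hk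
      have h7 := hsmall _ hκA
      simp only at h6
      linarith
    obtain ⟨hκ1, hκp⟩ := hκ
    refine ⟨κ - 1, by omega, ?_, ?_⟩
    · ext S
      constructor
      · intro hS
        obtain ⟨k, hk, rfl⟩ := hbij.surjOn (Set.mem_univ S)
        refine ⟨k, ⟨?_, hk.2⟩, rfl⟩
        by_contra hlt
        exact hbelow k hk.1 (by omega) hS
      · rintro ⟨k, hk, rfl⟩
        exact habove k (by have := hk.1; omega) hk.2
    -- Within `𝒜` the numerator is at least `c` and the denominator at most `(1 + η) * c`, so the
    -- ratio exceeds `c₀` by `h2`.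
    · have hi : ∀ k, κ ≤ k → k < 2 ^ p → c₀ < ridgeRatio f c₀ c A k := by
        intro k hk hkp
        rw [ridgeRatio, if_neg (by omega), lt_div_iff₀ (by have := hnonneg (A k); linarith)]
        have h5 := hsmall _ (habove k hk hkp.le)
        have h6 := hnonneg (A (k + 1))
        by_cases hc0 : 0 ≤ c₀
        · have := mul_le_mul_of_nonneg_left h5 hc0
          nlinarith
        · have := hnonneg (A k)
          nlinarith
      have hK : 1 < κ → ridgeRatio f c₀ c A (κ - 1) ≤ (η * c + c) / (δ + c) := by
        intro hκ'
        rw [ridgeRatio, if_neg (by omega), Nat.sub_add_cancel hκ1]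
        have h5 := hlow _ (hbelow (κ - 1) (by omega) (by omega))
        have h6 := hsmall _ hκA
        have h7 := hnonneg (A κ)
        exact div_le_div₀ (by positivity) (by linarith) (by positivity) (by linarith)
      have hlowk : ∀ k, 1 ≤ k → k + 1 < κ → (δ + c) / (B + c) ≤ ridgeRatio f c₀ c A k := by
        intro k hk1 hk
        rw [ridgeRatio, if_neg (by omega)]
        have h5 := hlow _ (hbelow (k + 1) (by omega) hk)
        have h6 := hB (A k)
        have h7 := hnonneg (A k)
        have h8 := hnonneg (A (k + 1))
        exact div_le_div₀ (by linarith) (by linarith) (by linarith) (by linarith)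
      intro k hkp hkK
      by_cases hκ' : 1 < κ
      · refine (hK hκ').trans_lt ?_
        rcases Nat.eq_zero_or_pos k with rfl | hk
        · rw [ridgeRatio, if_pos rfl]; exact h3
        · rcases lt_or_ge k κ with hk' | hk'
          · exact h4.trans_le (hlowk k hk (by omega))
          · exact h3.trans (hi k hk' hkp)
      -- Here every set is in `𝒜`, and the artificial value `c₀` at `k = 0` is the minimum.
      · have hκ0 : κ - 1 = 0 := by omega
        rw [hκ0] at hkK ⊢
        have : ridgeRatio f c₀ c A 0 = c₀ := if_pos rfl
        rw [this]
        exact hi k (by omega) hkp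
  ext C
  rw [Set.mem_singleton_iff]
  constructor
  · rintro ⟨A, τ, hbij, hanti, hτ, hmin, rfl⟩
    obtain ⟨K, hK, h𝒜K, hlt⟩ := key A hbij hanti
    have : τ = K := by
      by_contra hne
      exact absurd (hmin K hK) (not_le.2 (hlt τ hτ hne))
    rw [this, h𝒜K]
  · rintro rfl
    -- The rule must return something: an ordered enumeration exists, and its cut is a minimizer.
    obtain ⟨A, hbij, hanti⟩ := exists_antitone_enumeration f
    obtain ⟨K, hK, h𝒜K, hlt⟩ := key A hbij hanti
    refine ⟨A, K, hbij, hanti, hK, fun k hk => ?_, h𝒜K⟩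
    by_cases hkK : k = K
    · rw [hkK]
    · exact (hlt k hk hkK).le

end Ridge

/-! ### Consistency of the ridge ratio rule -/

section Consistency

variable {p : ℕ} {Ω : Type*} [MeasurableSpace Ω] {Q : Measure Ω}

/-- A finite family of rates holds simultaneously, with a common constant. -/
lemma exists_forall_rate {r : ℕ → ℝ} (hr : ∀ n, 0 ≤ r n) {ι : Type*} [Finite ι]
    {Z : ι → ℕ → Ω → ℝ} {z : ι → ℝ} (h : ∀ i, ConvRate Q r (Z i) (z i)) {ε : ℝ≥0∞} (hε : 0 < ε) :
    ∃ K : ℝ, 0 ≤ K ∧ ∀ᶠ n in atTop, Q {ω | ∃ i, K * r n < |Z i n ω - z i|} ≤ ε := by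
  have := Fintype.ofFinite ι
  by_cases htop : ε = ∞
  · exact ⟨0, le_rfl, Eventually.of_forall fun n => by rw [htop]; exact le_top⟩
  have hε' : 0 < ε / (Fintype.card ι + 1) := ENNReal.div_pos hε.ne' (by finiteness)
  choose K hK using fun i => h i _ hε'
  refine ⟨∑ i, |K i|, Finset.sum_nonneg fun _ _ => abs_nonneg _, ?_⟩
  filter_upwards [eventually_all.2 hK] with n hn
  calc Q {ω | ∃ i, (∑ i, |K i|) * r n < |Z i n ω - z i|}
      ≤ Q (⋃ i, {ω | K i * r n < |Z i n ω - z i|}) := by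
        refine measure_mono fun ω ⟨i, hi⟩ => Set.mem_iUnion.2 ⟨i, lt_of_le_of_lt ?_ hi⟩
        exact mul_le_mul_of_nonneg_right ((le_abs_self _).trans
          (Finset.single_le_sum (f := fun i => |K i|) (fun _ _ => abs_nonneg _)
            (Finset.mem_univ i))) (hr n)
    _ ≤ ∑ i, Q {ω | K i * r n < |Z i n ω - z i|} := measure_iUnion_fintype_le _ _
    _ ≤ ∑ _i : ι, ε / (Fintype.card ι + 1) := Finset.sum_le_sum fun i _ => hn i
    _ ≤ ε := by
        rw [Finset.sum_const, Finset.card_univ, nsmul_eq_mul, ← mul_div_assoc, mul_comm,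
          mul_div_assoc]
        refine mul_le_of_le_one_right' ?_
        exact ENNReal.div_le_of_le_mul (by rw [one_mul]; exact le_self_add)

/-- The ridge ratio rule is consistent when the criterion converges faster than the ridge
vanishes. -/
theorem tendsto_measure_isRidgeSelection [IsProbabilityMeasure Q] {r : ℕ → ℝ} (hr : ∀ n, 0 ≤ r n)
    (hr0 : Tendsto r atTop (𝓝 0)) {F : Finset (Fin p) → ℕ → Ω → ℝ} {f : Finset (Fin p) → ℝ}
    (hF : ∀ A, ConvRate Q r (F A) (f A)) (hFnn : ∀ A n ω, 0 ≤ F A n ω) (hfnn : ∀ A, 0 ≤ f A)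
    (hzero : ∃ A, f A = 0) {c₀ : ℝ} (hc₀ : c₀ ∈ Set.Ioo (0 : ℝ) 1) {c : ℕ → ℝ} (hc : ∀ n, 0 < c n)
    (hc_lim : Tendsto c atTop (𝓝 0)) (hc_rate : Tendsto (fun n => r n / c n) atTop (𝓝 0)) :
    Tendsto (fun n => Q {ω | {C | IsRidgeSelection (fun A => F A n ω) c₀ (c n) C} =
      {{A | f A = 0}}}) atTop (𝓝 1) := by
  obtain ⟨hc₀0, hc₀1⟩ := hc₀
  -- Half the least positive value of `f`, the other half absorbing the sampling error. The inserted
  -- 1 keeps the set nonempty if `f` vanishes identically.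
  obtain ⟨δ, hδ, hδf⟩ : ∃ δ > 0, ∀ A, f A ≠ 0 → 2 * δ ≤ f A := by
    classical
    set s := insert (1 : ℝ) ((Finset.univ.filter fun A => f A ≠ 0).image f)
    have hs : s.Nonempty := Finset.insert_nonempty _ _
    have hpos : ∀ x ∈ s, 0 < x := by
      intro x hx
      rcases Finset.mem_insert.1 hx with rfl | hx
      · exact one_pos
      · obtain ⟨A, hA, rfl⟩ := Finset.mem_image.1 hx
        exact lt_of_le_of_ne (hfnn A) (Ne.symm (Finset.mem_filter.1 hA).2)
    refine ⟨s.min' hs / 2, half_pos (hpos _ (s.min'_mem hs)), fun A hA => ?_⟩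
    rw [mul_div_cancel₀ _ two_ne_zero]
    exact s.min'_le _ (Finset.mem_insert_of_mem (Finset.mem_image.2 ⟨A, by simp [hA], rfl⟩))
  obtain ⟨B, hB⟩ : ∃ B, ∀ A, f A ≤ B := by
    obtain ⟨B, hB⟩ := (Set.finite_range f).bddAbove
    exact ⟨B, fun A => hB ⟨A, rfl⟩⟩
  have hB0 : 0 ≤ B := (hfnn ∅).trans (hB ∅)
  set bad : ℕ → Set Ω := fun n => {ω | {C | IsRidgeSelection (fun A => F A n ω) c₀ (c n) C} =
      {{A | f A = 0}}}ᶜ with hbad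
  have hbad0 : Tendsto (fun n => Q (bad n)) atTop (𝓝 0) := by
    refine ENNReal.tendsto_nhds_zero.2 fun ε hε => ?_
    obtain ⟨K, hK, hrate⟩ := exists_forall_rate hr hF hε
    have hηlim : Tendsto (fun n => K * (r n / c n)) atTop (𝓝 0) := by
      simpa using hc_rate.const_mul K
    have hKr : Tendsto (fun n => K * r n) atTop (𝓝 0) := by simpa using hr0.const_mul K
    have e2 : ∀ᶠ n in atTop, c₀ * (1 + K * (r n / c n)) < 1 := by
      have : Tendsto (fun n => c₀ * (1 + K * (r n / c n))) atTop (𝓝 (c₀ * (1 + 0))) :=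
        (hηlim.const_add 1).const_mul c₀
      exact this.eventually_lt_const (by simpa using hc₀1)
    have hfrac : Tendsto (fun n => (K * (r n / c n) * c n + c n) / (δ + c n)) atTop (𝓝 0) := by
      have : Tendsto (fun n => (K * (r n / c n) * c n + c n) / (δ + c n)) atTop
          (𝓝 ((0 * 0 + 0) / (δ + 0))) :=
        ((hηlim.mul hc_lim).add hc_lim).div (hc_lim.const_add δ) (by simpa using hδ.ne')
      simpa using this
    have e3 := hfrac.eventually_lt_const hc₀0
    have e4 : ∀ᶠ n in atTop, (K * (r n / c n) * c n + c n) / (δ + c n) <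
        (δ + c n) / (B + 1 + c n) := by
      have : Tendsto (fun n => (δ + c n) / (B + 1 + c n)) atTop (𝓝 ((δ + 0) / (B + 1 + 0))) :=
        (hc_lim.const_add δ).div (hc_lim.const_add _) (by positivity)
      exact hfrac.eventually_lt this (by positivity)
    filter_upwards [hrate, e2, e3, e4, hKr.eventually_lt_const hδ,
      hKr.eventually_lt_const one_pos] with n hn h2 h3 h4 h1 h5
    refine (measure_mono fun ω hω => ?_).trans hn
    by_contra hcon
    simp only [Set.mem_ofPred_eq, not_exists, not_lt] at hcon
    have hηc : K * (r n / c n) * c n = K * r n := by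
      rw [mul_assoc, div_mul_cancel₀ _ (hc n).ne']
    -- With `η = K * (r n / c n)` the bound `η * c n` is the error `K * r n`; the error is also
    -- below 1, whence `B + 1`.
    refine hω (setOf_isRidgeSelection_eq (hc n) (𝒜 := {A | f A = 0}) hzero
      (η := K * (r n / c n)) (δ := δ) (B := B + 1)
      (mul_nonneg hK (div_nonneg (hr n) (hc n).le)) hδ ?_ ?_ (fun A => hFnn A n ω) ?_
      (by rwa [hηc]) h2 h3 h4)
    · intro A hA
      have := (abs_le.1 (hcon A)).1
      have := hδf A hA
      linarith
    · intro A
      have := (abs_le.1 (hcon A)).2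
      have := hB A
      linarith
    · intro A hA
      have h6 := (abs_le.1 (hcon A)).2
      have hA' : f A = 0 := hA
      rw [hA', sub_zero] at h6
      rwa [hηc]
  have hlow : Tendsto (fun n => 1 - Q (bad n)) atTop (𝓝 1) := by
    have := ENNReal.Tendsto.sub tendsto_const_nhds hbad0 (Or.inl ENNReal.one_ne_top)
    simpa using this
  refine tendsto_of_tendsto_of_tendsto_of_le_of_le hlow tendsto_const_nhds (fun n => ?_)
    fun n => prob_le_one
  -- Subadditivity avoids any measurability of the event.
  refine tsub_le_iff_right.2 ?_
  calc (1 : ℝ≥0∞) = Q Set.univ := measure_univ.symm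
    _ = Q ({ω | {C | IsRidgeSelection (fun A => F A n ω) c₀ (c n) C} = {{A | f A = 0}}} ∪ bad n) := by
        rw [hbad, Set.union_compl_self]
    _ ≤ _ := measure_union_le _ _

end Consistency
end AdjustmentSets
-- The main theorem
theorem theorem2
    -- the population: predictor, binary treatment, potential outcomes
    {Ω : Type*} [MeasurableSpace Ω] [StandardBorelSpace Ω] (P : Measure Ω) [IsProbabilityMeasure P]
    {p : ℕ} (X : Ω → Fin p → ℝ) (T : Ω → Fin 2) (Y : Fin 2 → Ω → ℝ)
    (hX : Measurable X) (hT : Measurable T) (hY : ∀ s, Measurable (Y s))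
    -- the treatment level under study
    (t : Fin 2)
    -- ignorability
    (hign : ∀ s, AdjustmentSets.CondIndepGiven P (Y s) T X)
    -- common support
    (hsupp : ((AdjustmentSets.group P T 1).map X).support =
      ((AdjustmentSets.group P T 0).map X).support)
    -- matrices spanning the central subspaces of `Y(t) | X` and of `T | X`
    {dY dT : ℕ} (βY : Matrix (Fin p) (Fin dY) ℝ) (βT : Matrix (Fin p) (Fin dT) ℝ)
    (hβY : AdjustmentSets.IsCentralSubspace P (Y t) X (AdjustmentSets.colSpan βY))
    (hβT : AdjustmentSets.IsCentralSubspace P T X (AdjustmentSets.colSpan βT))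
    (hreg : AdjustmentSets.Regular P X T (Y t) βY βT)
    -- normality within each treatment group, with nonsingular covariance matrix
    (hnormal : ∀ s, IsGaussian ((AdjustmentSets.group P T s).map X))
    (hpos : ∀ s, (AdjustmentSets.groupCov P X T s).PosDef)
    -- candidate matrices: they span the central subspaces, for the outcome in the group `T = t`
    {q r : ℕ} (MY : Matrix (Fin p) (Fin q) ℝ) (MT : Matrix (Fin p) (Fin r) ℝ)
    (hMY : AdjustmentSets.IsCentralSubspace (AdjustmentSets.group P T t) (Y t) X
      (AdjustmentSets.colSpan MY))
    (hMT : AdjustmentSets.IsCentralSubspace P T X (AdjustmentSets.colSpan MT))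
    -- an i.i.d. sample of observed records
    {Ω' : Type*} [MeasurableSpace Ω'] (Q : Measure Ω') [IsProbabilityMeasure Q]
    (D : ℕ → Ω' → AdjustmentSets.Record p) (hindep : iIndepFun D Q)
    (hident : ∀ i, IdentDistrib (D i) (AdjustmentSets.record X T Y) Q P)
    -- root-n-consistent estimators of the candidate matrices, computed from the sample
    (MYhat : ∀ n : ℕ, (Fin n → AdjustmentSets.Record p) → Matrix (Fin p) (Fin q) ℝ)
    (MThat : ∀ n : ℕ, (Fin n → AdjustmentSets.Record p) → Matrix (Fin p) (Fin r) ℝ)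
    (hMYmeas : ∀ n i j, Measurable fun d => MYhat n d i j)
    (hMTmeas : ∀ n i j, Measurable fun d => MThat n d i j)
    (hMYhat : AdjustmentSets.IsBigOInProbability Q
      (fun n ω => ‖MYhat n (fun k => D k ω) - MY‖) (fun n => (√(n : ℝ))⁻¹))
    (hMThat : AdjustmentSets.IsBigOInProbability Q
      (fun n ω => ‖MThat n (fun k => D k ω) - MT‖) (fun n => (√(n : ℝ))⁻¹))
    -- tuning constants
    (c₀ : ℝ) (hc₀ : c₀ ∈ Set.Ioo (0 : ℝ) 1) (c : ℕ → ℝ) (hc : ∀ n, 0 < c n)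
    (hc_lim : Tendsto c atTop (𝓝 0))
    (hc_rate : Tendsto (fun n : ℕ => (√(n : ℝ))⁻¹ / c n) atTop (𝓝 0)) :
    -- with probability tending to one, the rule returns the true collection, however ties are broken
    Tendsto (fun n : ℕ => Q {ω | {C | AdjustmentSets.IsRidgeSelection
        (AdjustmentSets.sampleCriterion (MYhat n) (MThat n) (fun k => D k ω)) c₀ (c n) C} =
        {AdjustmentSets.sufficientSets P X T (Y t)}})
      atTop (𝓝 1) := by
  have hzero := AdjustmentSets.mem_sufficientSets_iff_criterion_eq_zero hX hT (hY t) (hign t)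
    hβY hβT hreg hnormal hpos hMY hMT
  have hset : AdjustmentSets.sufficientSets P X T (Y t) =
      {A | AdjustmentSets.criterion MY MT (AdjustmentSets.groupCov P X T) A = 0} := Set.ext hzero
  rw [hset]
  refine AdjustmentSets.tendsto_measure_isRidgeSelection AdjustmentSets.rate_nonneg
    AdjustmentSets.tendsto_rate
    (F := fun A n ω => AdjustmentSets.sampleCriterion (MYhat n) (MThat n) (fun k => D k ω) A)
    (fun A => ?_) (fun A n ω => AdjustmentSets.criterion_nonneg _ _ _ A)
    (fun A => AdjustmentSets.criterion_nonneg _ _ _ A) ⟨Finset.univ, ?_⟩ hc₀ hc hc_lim hc_rate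
  · exact AdjustmentSets.convRate_criterion AdjustmentSets.rate_nonneg AdjustmentSets.tendsto_rate
      (AdjustmentSets.matConvRate_of_norm AdjustmentSets.rate_nonneg AdjustmentSets.tendsto_rate
        hMYhat)
      (AdjustmentSets.matConvRate_of_norm AdjustmentSets.rate_nonneg AdjustmentSets.tendsto_rate
        hMThat)
      (fun s => AdjustmentSets.matConvRate_sampleCov hT ⟨hnormal s⟩ hindep hident) hpos A
  -- The full index set leaves no rows outside it, so the population criterion has a zero.
  · rw [AdjustmentSets.criterion_eq_sum]
    refine Finset.sum_eq_zero fun s _ => ?_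
    have : IsEmpty {i : Fin p // i ∉ (Finset.univ : Finset (Fin p))} :=
      ⟨fun i => i.2 (Finset.mem_univ _)⟩
    rw [norm_eq_zero]
    ext k l
    exact Matrix.mul_apply.trans (Finset.sum_eq_zero fun i _ => this.elim i)
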